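/- Let $n\ge 2$ and let $\mu_1,\dots,\mu_n>0$ be real. Let $V$ be a real or complex vector space that is a representation space of the Clifford algebra $\mathcal{C}\ell_n$ generated by $e_1,\dots,e_n$ with $e_ie_j+e_je_i=-2\delta_{ij}$, and let $\{v_s\}_{s\in I}$ be a basis of $V$. Let $\mathcal{P}_k(\mathbb{R}^n)$ be the space of homogeneous polynomials of degree $k$ in $x_1,\dots,x_n$ (with coefficients in the scalar field of $V$). Let $r_i$ be the reflection $x_i\mapsto -x_i$, let $T_i=\partial_{x_i}+\frac{\mu_i}{x_i}(1-r_i)$ be the Dunkl operators, and for $\ell\le n$ put $$\underline{D}_{[\ell]}=\sum_{i=1}^{\ell}e_iT_i,\qquad \underline{x}_{[\ell]}=\sum_{i=1}^{\ell}e_ix_i .$$ Let $\mathcal{M}_k(\mathbb{R}^n;V)=\ker \underline{D}_{[n]}\cap(\mathcal{P}_k(\mathbb{R}^n)\otimes V)$ be the space of $k$-homogeneous Dunkl monogenics. For $2\le j\le n$ define the operator on $V$-valued polynomials $$\mathbf{CK}_{x_j}^{\mu_j}=\Gamma(\mu_j+\tfrac12)\Big[\widetilde{I}_{\mu_j-1/2}(x_j\underline{D}_{[j-1]})+\tfrac12\,e_jx_j\underline{D}_{[j-1]}\,\widetilde{I}_{\mu_j+1/2}(x_j\underline{D}_{[j-1]})\Big],\qquad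 \widetilde{I}_\alpha(x)=\sum_{l\ge 0}\frac{(x/2)^{2l}}{l!\,\Gamma(l+\alpha+1)} ,$$ where the series reduce to finite sums on each polynomial ($\widetilde I_\alpha(x)=(2/x)^\alpha I_\alpha(x)$ with $I_\alpha$ the modified Bessel function). Fix an integer $k\ge 0$. For $\mathbf{j}=(j_1,\dots,j_{n-2},\,j_{n-1}=k-\sum_{i=1}^{n-2}j_i)$, where $j_1,\dots,j_{n-2}$ are non-negative integers with $\sum_{i=1}^{n-2}j_i\le k$, and for $s\in I$, define $$\Psi_{\mathbf{j}}^{s}=\mathbf{CK}_{x_n}^{\mu_n}\Big[\underline{x}_{[n-1]}^{j_{n-1}}\,\mathbf{CK}_{x_{n-1}}^{\mu_{n-1}}\Big[\underline{x}_{[n-2]}^{j_{n-2}}\cdots\mathbf{CK}_{x_3}^{\mu_3}\big[\underline{x}_{[2]}^{j_2}\,\mathbf{CK}_{x_2}^{\mu_2}[x_1^{j_1}]\big]\Big]\Big]v_s .$$ Then the functions $\Psi_{\mathbf{j}}^{s}$, indexed by all such pairs $(\mathbf{j},s)$, form a basis of $\mathcal{M}_k(\mathbb{R}^n;V)$. 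-/

import Mathlib

open scoped TensorProduct

noncomputable section

namespace DunklDirac

variable (𝕜 : Type*) [RCLike 𝕜]

/-- The negative definite form `-(x₁² + ⋯ + xₙ²)`, so that in its Clifford algebra the
generators satisfy `eᵢ eⱼ + eⱼ eᵢ = -2 δᵢⱼ`. -/
def negForm (n : ℕ) : QuadraticForm 𝕜 (Fin n → 𝕜) :=
  QuadraticMap.weightedSumSquares 𝕜 (fun _ : Fin n => (-1 : 𝕜))

/-- The Clifford algebra of negative signature on `n` generators. -/
abbrev Cl (n : ℕ) : Type _ := CliffordAlgebra (negForm 𝕜 n)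

variable {𝕜}

/-- The generator `eᵢ`. -/
def gen {n : ℕ} (i : Fin n) : Cl 𝕜 n := CliffordAlgebra.ι (negForm 𝕜 n) (Pi.single i 1)

/-- The reflection `rᵢ`, changing the sign of the variable `xᵢ`. -/
def reflection {n : ℕ} (i : Fin n) : MvPolynomial (Fin n) 𝕜 →ₐ[𝕜] MvPolynomial (Fin n) 𝕜 :=
  MvPolynomial.aeval (Function.update MvPolynomial.X i (-MvPolynomial.X i))

/-- Division by the variable `xᵢ` (monomials without `xᵢ` are dropped). It is only applied to
polynomials divisible by `xᵢ`, see `X_mul_divX`. -/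
def divX {n : ℕ} (i : Fin n) : MvPolynomial (Fin n) 𝕜 →ₗ[𝕜] MvPolynomial (Fin n) 𝕜 where
  toFun p := p.divMonomial (Finsupp.single i 1)
  map_add' p q := MvPolynomial.add_divMonomial p q _
  map_smul' c p := by
    ext m
    simp [MvPolynomial.coeff_divMonomial]

/-- The polynomial `p - rᵢ p` is divisible by `xᵢ`, and `divX` is the exact quotient. -/
theorem X_mul_divX {n : ℕ} (i : Fin n) (p : MvPolynomial (Fin n) 𝕜) :
    MvPolynomial.X i * divX i (p - reflection i p) = p - reflection i p := by
  have hdvd : MvPolynomial.X i ∣ p - reflection i p := by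
    induction p using MvPolynomial.induction_on with
    | C a => simp [reflection, MvPolynomial.algebraMap_eq]
    | add p q hp hq =>
      have h := dvd_add hp hq
      rw [map_add]
      convert h using 1
      ring
    | mul_X p l hp =>
      by_cases hl : l = i
      · subst hl
        refine ⟨p + reflection l p, ?_⟩
        simp [reflection]
        ring
      · have hX : reflection (𝕜 := 𝕜) i (MvPolynomial.X l) = MvPolynomial.X l := by
          simp [reflection, hl]
        rw [map_mul, hX, ← sub_mul]
        exact hp.mul_right _
  have h := MvPolynomial.divMonomial_add_modMonomial_single (p - reflection i p) i
  rw [MvPolynomial.X_dvd_iff_modMonomial_eq_zero.mp hdvd, add_zero] at h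
  exact h

/-- The Dunkl operator `Tᵢ = ∂ᵢ + (μᵢ / xᵢ) (1 - rᵢ)`. -/
def dunkl {n : ℕ} (μ : Fin n → ℝ) (i : Fin n) :
    MvPolynomial (Fin n) 𝕜 →ₗ[𝕜] MvPolynomial (Fin n) 𝕜 :=
  (MvPolynomial.pderiv i).toLinearMap +
    ((μ i : ℝ) : 𝕜) • (divX i ∘ₗ (LinearMap.id - (reflection i).toLinearMap))

section Operators

variable {n : ℕ} {V : Type*} [AddCommGroup V] [Module 𝕜 V]

/-- Multiplication by the variable `xᵢ` on `V`-valued polynomials. -/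
def mulX (V : Type*) [AddCommGroup V] [Module 𝕜 V] (i : Fin n) :
    Module.End 𝕜 (MvPolynomial (Fin n) 𝕜 ⊗[𝕜] V) :=
  TensorProduct.map (LinearMap.mulLeft 𝕜 (MvPolynomial.X i)) LinearMap.id

/-- Action of the generator `eᵢ` on `V`-valued polynomials. -/
def mulE (ρ : Cl 𝕜 n →ₐ[𝕜] Module.End 𝕜 V) (i : Fin n) :
    Module.End 𝕜 (MvPolynomial (Fin n) 𝕜 ⊗[𝕜] V) :=
  TensorProduct.map LinearMap.id (ρ (gen i))

/-- The Dunkl operator `Tᵢ` on `V`-valued polynomials. -/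
def dunklV (V : Type*) [AddCommGroup V] [Module 𝕜 V] (μ : Fin n → ℝ) (i : Fin n) :
    Module.End 𝕜 (MvPolynomial (Fin n) 𝕜 ⊗[𝕜] V) :=
  TensorProduct.map (dunkl μ i) LinearMap.id

/-- The Dirac--Dunkl operator `D_A = ∑_{i ∈ A} eᵢ Tᵢ`. -/
def dirac (ρ : Cl 𝕜 n →ₐ[𝕜] Module.End 𝕜 V) (μ : Fin n → ℝ) (A : Finset (Fin n)) :
    Module.End 𝕜 (MvPolynomial (Fin n) 𝕜 ⊗[𝕜] V) :=
  ∑ i ∈ A, mulE ρ i * dunklV V μ i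

/-- The position operator `x_A = ∑_{i ∈ A} eᵢ xᵢ`. -/
def position (ρ : Cl 𝕜 n →ₐ[𝕜] Module.End 𝕜 V) (A : Finset (Fin n)) :
    Module.End 𝕜 (MvPolynomial (Fin n) 𝕜 ⊗[𝕜] V) :=
  ∑ i ∈ A, mulE ρ i * mulX V i

/-- The space `𝒫ₖ(ℝⁿ) ⊗ V` of `V`-valued homogeneous polynomials of degree `k`. -/
def homogeneousV (n : ℕ) (V : Type*) [AddCommGroup V] [Module 𝕜 V] (k : ℕ) :
    Submodule 𝕜 (MvPolynomial (Fin n) 𝕜 ⊗[𝕜] V) :=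
  LinearMap.range
    (TensorProduct.map (MvPolynomial.homogeneousSubmodule (Fin n) 𝕜 k).subtype
      (LinearMap.id : V →ₗ[𝕜] V))

/-- The space `ℳₖ(ℝⁿ; V)` of Dunkl monogenics of degree `k`. -/
def monogenics (ρ : Cl 𝕜 n →ₐ[𝕜] Module.End 𝕜 V) (μ : Fin n → ℝ) (k : ℕ) :
    Submodule 𝕜 (MvPolynomial (Fin n) 𝕜 ⊗[𝕜] V) :=
  LinearMap.ker (dirac ρ μ Finset.univ) ⊓ homogeneousV n V k

/-- The coefficient of `x ^ (2 l)` in the entire function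
`Ĩ_α(x) = (2 / x) ^ α * I_α(x) = ∑ₗ (x / 2) ^ (2 l) / (l! Γ(l + α + 1))`,
with `I_α` the modified Bessel function. -/
def besselCoeff (α : ℝ) (l : ℕ) : ℝ :=
  1 / (2 ^ (2 * l) * (l.factorial : ℝ) * Real.Gamma (l + α + 1))

/-- `Ĩ_α(N) f`, for an operator `N` such that `N ^ l f = 0` for large `l`. -/
def besselApply {E : Type*} [AddCommGroup E] [Module 𝕜 E] (α : ℝ) (N : Module.End 𝕜 E)
    (f : E) : E :=
  ∑ᶠ l : ℕ, ((besselCoeff α l : ℝ) : 𝕜) • (N ^ (2 * l)) f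

/-- The Cauchy--Kovalevskaia operator in the variable `xⱼ`,
`Γ(μⱼ + 1/2) [Ĩ_{μⱼ - 1/2}(xⱼ D) + (1/2) eⱼ xⱼ D Ĩ_{μⱼ + 1/2}(xⱼ D)]`,
where `D` is the Dirac--Dunkl operator in the variables preceding `xⱼ`. -/
def CK (ρ : Cl 𝕜 n →ₐ[𝕜] Module.End 𝕜 V) (μ : Fin n → ℝ) (j : Fin n)
    (f : MvPolynomial (Fin n) 𝕜 ⊗[𝕜] V) : MvPolynomial (Fin n) 𝕜 ⊗[𝕜] V :=
  ((Real.Gamma (μ j + 1 / 2) : ℝ) : 𝕜) •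
    (besselApply (μ j - 1 / 2) (mulX V j * dirac ρ μ (Finset.Iio j)) f +
      (1 / 2 : 𝕜) • mulE ρ j (mulX V j (dirac ρ μ (Finset.Iio j)
        (besselApply (μ j + 1 / 2) (mulX V j * dirac ρ μ (Finset.Iio j)) f))))

end Operators

section Basis

variable {m : ℕ} {V : Type*} [AddCommGroup V] [Module 𝕜 V]

/-- The nested extensions in dimension `n = m + 2`. With variables `x₁, …, xₙ` and exponents
`j₁, …, jₙ₋₁` (numbered from `0` in `Fin (m + 2)` and `Fin (m + 1)`), the value at `0` is
`CK_{x₂}[x₁^{j₁} v]`, and each later value is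
`CK_{x_ℓ}[x_{[ℓ-1]}^{j_{ℓ-1}} (previous value)]`, up to `ℓ = n` at `Fin.last m`. -/
def nested (ρ : Cl 𝕜 (m + 2) →ₐ[𝕜] Module.End 𝕜 V) (μ : Fin (m + 2) → ℝ)
    (j : Fin (m + 1) → ℕ) (v : V) :
    Fin (m + 1) → MvPolynomial (Fin (m + 2)) 𝕜 ⊗[𝕜] V :=
  Fin.induction
    (CK ρ μ 1 ((MvPolynomial.X 0 ^ j 0) ⊗ₜ[𝕜] v))
    (fun i previous =>
      CK ρ μ i.succ.succ
        ((position ρ (Finset.Iio i.succ.succ) ^ j i.succ) previous))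

/-- The function `Ψ_j^s` for the basis vector `v = v_s`. -/
def Psi (ρ : Cl 𝕜 (m + 2) →ₐ[𝕜] Module.End 𝕜 V) (μ : Fin (m + 2) → ℝ)
    (j : Fin (m + 1) → ℕ) (v : V) : MvPolynomial (Fin (m + 2)) 𝕜 ⊗[𝕜] V :=
  nested ρ μ j v (Fin.last m)

end Basis

end DunklDirac

end

open scoped TensorProduct
open Finset.HasAntidiagonal (antidiagonal mem_antidiagonal)

/-! Two isomorphisms alternate as variables are added one at a time. The first is restriction to `xⱼ
= 0`, from homogeneous monogenics in `x₁, …, xⱼ` to all homogeneous polynomials of the same degree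
in `x₁, …, xⱼ₋₁`. With `D` the Dirac operator in the earlier variables, monogenicity of `g` reads
`Tⱼ g = eⱼ D g`. As `Tⱼ` sends `xⱼ ^ r`, `r > 0`, to a nonzero multiple of `xⱼ ^ (r - 1)`, the
restriction determines `g` (`eq_zero_of_restrictZero_eq_zero`). Solving the recursion produces the
Bessel coefficients, so the Cauchy--Kovalevskaia operator is the inverse (`dirac_CK`,
`restrictZero_CK`, `CK_restrictZero`).

The second is the Fischer decomposition. In degree `k` the anticommutator of position and Dirac
operators is the scalar `-(2k + ∑ (1 + 2μᵢ))` (`position_dirac_add`). Hence each polynomial is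
uniquely a sum of powers of the position operator applied to monogenics (`exists_fischer`,
`fischer_unique`).

Starting from the polynomials `x₁ ^ k v` and alternating the two, every monogenic becomes a sum over
exponents `j` of the nested extension of some vector `w j`, with `w` unique (`exists_nestedSum`,
`eq_zero_of_nestedSum_eq_zero`). So the monogenics form a finite power of `V`, on which a basis of
`V` induces one. No dimension count is used, so `V` may be infinite-dimensional. -/

namespace DunklDirac

/-! ### Operators on monomials, and the Clifford relations. -/

section Monomials

variable {𝕜 : Type*} [RCLike 𝕜] {n : ℕ} {V : Type*} [AddCommGroup V] [Module 𝕜 V]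

/-- The `V`-valued monomial `x ^ d ⊗ v`, as a linear function of `v`. -/
noncomputable def mon (𝕜 : Type*) [RCLike 𝕜] {n : ℕ} {V : Type*} [AddCommGroup V] [Module 𝕜 V]
    (d : Fin n →₀ ℕ) : V →ₗ[𝕜] MvPolynomial (Fin n) 𝕜 ⊗[𝕜] V :=
  TensorProduct.mk 𝕜 _ _ (MvPolynomial.monomial d 1)

theorem mon_apply (d : Fin n →₀ ℕ) (v : V) :
    mon 𝕜 d v = MvPolynomial.monomial d (1 : 𝕜) ⊗ₜ[𝕜] v := rfl

/-- Reduces every operator identity below to arithmetic of exponents and weights. -/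
theorem hom_ext {W : Type*} [AddCommGroup W] [Module 𝕜 W]
    {f g : MvPolynomial (Fin n) 𝕜 ⊗[𝕜] V →ₗ[𝕜] W}
    (h : ∀ d v, f (mon 𝕜 d v) = g (mon 𝕜 d v)) : f = g := by
  refine TensorProduct.ext (MvPolynomial.linearMap_ext fun d => LinearMap.ext_ring ?_)
  ext v
  exact h d v

/-- The factor in `Tᵢ xᵢ ^ r = (r + c (1 - (-1) ^ r)) xᵢ ^ (r - 1)`. -/
def dunklWeight (𝕜 : Type*) [RCLike 𝕜] (c : ℝ) (r : ℕ) : 𝕜 := r + c * (1 - (-1) ^ r)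

@[simp] theorem dunklWeight_zero (c : ℝ) : dunklWeight 𝕜 c 0 = 0 := by simp [dunklWeight]

theorem dunklWeight_even (c : ℝ) (l : ℕ) : dunklWeight 𝕜 c (2 * l) = 2 * l := by
  simp [dunklWeight, pow_mul]

theorem dunklWeight_odd (c : ℝ) (l : ℕ) :
    dunklWeight 𝕜 c (2 * l + 1) = 2 * l + 1 + 2 * c := by
  simp [dunklWeight, pow_mul, pow_add]
  ring

/-- Exactly one of `r` and `r + 1` is odd, so the reflection term contributes `2c` whatever the
parity. -/
theorem dunklWeight_add (c : ℝ) (r : ℕ) :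
    dunklWeight 𝕜 c r + dunklWeight 𝕜 c (r + 1) = 2 * r + 1 + 2 * c := by
  simp [dunklWeight, pow_succ]
  ring

theorem dunklWeight_ne_zero {c : ℝ} (hc : 0 < c) {r : ℕ} (hr : r ≠ 0) :
    dunklWeight 𝕜 c r ≠ 0 := by
  have h : (r + c * (1 - (-1) ^ r) : ℝ) ≠ 0 := by
    have : (0 : ℝ) < r := by exact_mod_cast hr.bot_lt
    rcases Nat.even_or_odd r with h | h <;> simp only [h.neg_one_pow] <;> nlinarith
  unfold dunklWeight
  exact_mod_cast h

theorem reflection_monomial (i : Fin n) (d : Fin n →₀ ℕ) :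
    reflection i (MvPolynomial.monomial d (1 : 𝕜)) =
      (-1 : 𝕜) ^ d i • MvPolynomial.monomial d 1 := by
  have h : ∀ k : Fin n, (Function.update MvPolynomial.X i (-MvPolynomial.X i) :
      Fin n → MvPolynomial (Fin n) 𝕜) k ^ d k =
        (if k = i then (-1) ^ d i else 1) * MvPolynomial.X k ^ d k := by
    intro k
    by_cases hk : k = i
    · subst hk
      simp [neg_pow (MvPolynomial.X k : MvPolynomial (Fin n) 𝕜) (d k)]
    · simp [hk]
  rw [reflection, MvPolynomial.aeval_monomial, map_one, one_mul,
    Finsupp.prod_fintype _ _ (by simp), Finset.prod_congr rfl fun k _ => h k,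
    Finset.prod_mul_distrib, Finset.prod_ite_eq' Finset.univ i, MvPolynomial.monomial_eq,
    Finsupp.prod_fintype _ _ (by simp), MvPolynomial.smul_eq_C_mul]
  simp

theorem divX_monomial {i : Fin n} {d : Fin n →₀ ℕ} (hd : d i ≠ 0) :
    divX i (MvPolynomial.monomial d (1 : 𝕜)) =
      MvPolynomial.monomial (d - Finsupp.single i 1) 1 := by
  ext e
  change (MvPolynomial.divMonomial _ _).coeff e = _
  have : d = Finsupp.single i 1 + e ↔ d - Finsupp.single i 1 = e := by
    have hle : Finsupp.single i 1 ≤ d := by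
      simpa [Nat.one_le_iff_ne_zero] using hd
    constructor
    · rintro rfl
      simp
    · rintro rfl
      exact (add_tsub_cancel_of_le hle).symm
  simp [MvPolynomial.coeff_divMonomial, MvPolynomial.coeff_monomial, this]

theorem dunkl_monomial (μ : Fin n → ℝ) (i : Fin n) (d : Fin n →₀ ℕ) :
    dunkl μ i (MvPolynomial.monomial d (1 : 𝕜)) =
      dunklWeight 𝕜 (μ i) (d i) •
        MvPolynomial.monomial (d - Finsupp.single i 1) 1 := by
  have h : (LinearMap.id - (reflection i).toLinearMap : _ →ₗ[𝕜] _)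
      (MvPolynomial.monomial d (1 : 𝕜)) =
        (1 - (-1 : 𝕜) ^ d i) • MvPolynomial.monomial d 1 := by
    simp [reflection_monomial, sub_smul]
  simp only [dunkl, LinearMap.add_apply, LinearMap.smul_apply, LinearMap.comp_apply, h, map_smul]
  by_cases hd : d i = 0
  · simp [hd, MvPolynomial.pderiv_monomial]
  · rw [divX_monomial hd, smul_smul, Derivation.coeFn_coe, MvPolynomial.pderiv_monomial]
    simp only [MvPolynomial.smul_monomial, dunklWeight, ← map_add]
    simp

@[simp] theorem mulX_mon (i : Fin n) (d : Fin n →₀ ℕ) (v : V) :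
    mulX V i (mon 𝕜 d v) = mon 𝕜 (d + Finsupp.single i 1) v := by
  rw [mon_apply, mon_apply, mulX, TensorProduct.map_tmul, LinearMap.mulLeft_apply,
    MvPolynomial.X, MvPolynomial.monomial_mul, one_mul, add_comm, LinearMap.id_apply]

@[simp] theorem mulE_mon (ρ : Cl 𝕜 n →ₐ[𝕜] Module.End 𝕜 V) (i : Fin n) (d : Fin n →₀ ℕ) (v : V) :
    mulE ρ i (mon 𝕜 d v) = mon 𝕜 d (ρ (gen i) v) := rfl

@[simp] theorem dunklV_mon (μ : Fin n → ℝ) (i : Fin n) (d : Fin n →₀ ℕ) (v : V) :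
    dunklV V μ i (mon 𝕜 d v) =
      dunklWeight 𝕜 (μ i) (d i) • mon 𝕜 (d - Finsupp.single i 1) v := by
  rw [mon_apply, mon_apply, dunklV, TensorProduct.map_tmul, dunkl_monomial, LinearMap.id_apply,
    TensorProduct.smul_tmul']

/-- Restriction to the hyperplane `xⱼ = 0`. -/
noncomputable def restrictZero (𝕜 : Type*) [RCLike 𝕜] {n : ℕ} (V : Type*) [AddCommGroup V]
    [Module 𝕜 V] (j : Fin n) : Module.End 𝕜 (MvPolynomial (Fin n) 𝕜 ⊗[𝕜] V) :=
  TensorProduct.map ((MvPolynomial.basisMonomials (Fin n) 𝕜).constr 𝕜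
    fun d => if d j = 0 then MvPolynomial.monomial d 1 else 0) LinearMap.id

@[simp] theorem restrictZero_mon (j : Fin n) (d : Fin n →₀ ℕ) (v : V) :
    restrictZero 𝕜 V j (mon 𝕜 d v) = if d j = 0 then mon 𝕜 d v else 0 := by
  have := (MvPolynomial.basisMonomials (Fin n) 𝕜).constr_basis 𝕜
    (fun d => if d j = 0 then MvPolynomial.monomial d (1 : 𝕜) else 0) d
  rw [MvPolynomial.coe_basisMonomials] at this
  rw [mon_apply, restrictZero, TensorProduct.map_tmul, this]
  split_ifs <;> simp

/-- The right inverse of the Dunkl operator `Tⱼ` whose values vanish on `xⱼ = 0`. -/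
noncomputable def antiDunkl {𝕜 : Type*} [RCLike 𝕜] {n : ℕ} (V : Type*) [AddCommGroup V]
    [Module 𝕜 V] (μ : Fin n → ℝ) (j : Fin n) : Module.End 𝕜 (MvPolynomial (Fin n) 𝕜 ⊗[𝕜] V) :=
  TensorProduct.map ((MvPolynomial.basisMonomials (Fin n) 𝕜).constr 𝕜
    fun d => (dunklWeight 𝕜 (μ j) (d j + 1))⁻¹ •
      MvPolynomial.monomial (d + Finsupp.single j 1) 1) LinearMap.id

@[simp] theorem antiDunkl_mon (μ : Fin n → ℝ) (j : Fin n) (d : Fin n →₀ ℕ) (v : V) :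
    antiDunkl V μ j (mon 𝕜 d v) =
      (dunklWeight 𝕜 (μ j) (d j + 1))⁻¹ • mon 𝕜 (d + Finsupp.single j 1) v := by
  have := (MvPolynomial.basisMonomials (Fin n) 𝕜).constr_basis 𝕜
    (fun d => (dunklWeight 𝕜 (μ j) (d j + 1))⁻¹ •
      MvPolynomial.monomial (d + Finsupp.single j 1) (1 : 𝕜)) d
  rw [MvPolynomial.coe_basisMonomials] at this
  rw [mon_apply, mon_apply, antiDunkl, TensorProduct.map_tmul, this, LinearMap.id_apply,
    TensorProduct.smul_tmul']

theorem single_one_add_tsub {i : Fin n} {d : Fin n →₀ ℕ} (hd : d i ≠ 0) :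
    d - Finsupp.single i 1 + Finsupp.single i 1 = d :=
  tsub_add_cancel_of_le (by simpa [Nat.one_le_iff_ne_zero] using hd)

/-- Positivity of `μ j` makes the weights of positive exponents invertible, so `Tⱼ` loses only the
part free of `xⱼ`. -/
theorem antiDunkl_dunklV {μ : Fin n → ℝ} {j : Fin n} (hμ : 0 < μ j) :
    restrictZero 𝕜 V j + antiDunkl V μ j * dunklV V μ j = 1 := by
  refine hom_ext fun d v => ?_
  by_cases hd : d j = 0
  · simp [hd]
  · have h' := dunklWeight_ne_zero (𝕜 := 𝕜) hμ hd
    have h1 : d j - 1 + 1 = d j := by omega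
    simp [hd, h1, single_one_add_tsub hd, smul_smul, mul_inv_cancel₀ h']

theorem mulE_mulX (ρ : Cl 𝕜 n →ₐ[𝕜] Module.End 𝕜 V) (i j : Fin n) :
    Commute (mulE ρ i) (mulX V j) := hom_ext fun d v => by simp

theorem mulE_dunklV (ρ : Cl 𝕜 n →ₐ[𝕜] Module.End 𝕜 V) (μ : Fin n → ℝ) (i j : Fin n) :
    Commute (mulE ρ i) (dunklV V μ j) := hom_ext fun d v => by simp

theorem mulE_restrictZero (ρ : Cl 𝕜 n →ₐ[𝕜] Module.End 𝕜 V) (i j : Fin n) :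
    Commute (mulE ρ i) (restrictZero 𝕜 V j) := hom_ext fun d v => by
  simp only [Module.End.mul_apply, restrictZero_mon, mulE_mon]
  split_ifs <;> simp

theorem dunklV_mulX (μ : Fin n → ℝ) {i j : Fin n} (h : i ≠ j) :
    Commute (dunklV (𝕜 := 𝕜) V μ i) (mulX V j) := hom_ext fun d v => by
  have hd : d + Finsupp.single j 1 - Finsupp.single i 1 =
      d - Finsupp.single i 1 + Finsupp.single j 1 := by
    ext k
    simp only [Finsupp.coe_tsub, Finsupp.coe_add, Pi.sub_apply, Pi.add_apply, Finsupp.single_apply]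
    split_ifs <;> omega
  simp [hd, h.symm]

theorem dunklV_dunklV (μ : Fin n → ℝ) {i j : Fin n} (h : i ≠ j) :
    Commute (dunklV (𝕜 := 𝕜) V μ i) (dunklV V μ j) := hom_ext fun d v => by
  simp [h, h.symm, smul_smul, mul_comm, tsub_right_comm]

theorem dunklV_restrictZero (μ : Fin n → ℝ) {i j : Fin n} (h : i ≠ j) :
    Commute (dunklV (𝕜 := 𝕜) V μ i) (restrictZero 𝕜 V j) := hom_ext fun d v => by
  by_cases hd : d j = 0 <;> simp [hd, h]

theorem mulX_dunklV_add (μ : Fin n → ℝ) (i : Fin n) (d : Fin n →₀ ℕ) (v : V) :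
    mulX V i (dunklV V μ i (mon 𝕜 d v)) + dunklV V μ i (mulX V i (mon 𝕜 d v)) =
      (2 * d i + 1 + 2 * μ i : 𝕜) • mon 𝕜 d v := by
  rw [← dunklWeight_add, add_smul]
  by_cases hd : d i = 0
  · simp [hd]
  · simp [single_one_add_tsub hd]

theorem gen_mul_gen_add (i j : Fin n) :
    gen i * gen j + gen j * gen i = algebraMap 𝕜 (Cl 𝕜 n) (if i = j then -2 else 0) := by
  rw [gen, gen, CliffordAlgebra.ι_mul_ι_add_swap, QuadraticMap.polar]
  simp only [negForm, QuadraticMap.weightedSumSquares_apply, Pi.add_apply, smul_eq_mul,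
    Pi.single_apply]
  -- Isolates the cross term of the polar form, supported at `x = i` and nonzero only for `i = j`.
  have : ∀ x, (-1 : 𝕜) * (((if x = i then 1 else 0) + if x = j then 1 else 0) *
      ((if x = i then 1 else 0) + if x = j then 1 else 0)) =
      -1 * ((if x = i then 1 else 0) * (if x = i then 1 else 0)) +
      (-1 * ((if x = j then 1 else 0) * (if x = j then 1 else 0)) +
      if x = i then (if i = j then -2 else 0) else 0) := by
    intro x
    split_ifs <;> subst_vars <;> first | contradiction | norm_num
  rw [Finset.sum_congr rfl fun x _ => this x, Finset.sum_add_distrib, Finset.sum_add_distrib]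
  rw [Finset.sum_ite_eq' Finset.univ i]
  simp
  rfl

theorem mulE_mulE_add (ρ : Cl 𝕜 n →ₐ[𝕜] Module.End 𝕜 V) (i j : Fin n) :
    mulE ρ i * mulE ρ j + mulE ρ j * mulE ρ i = (if i = j then -2 else 0 : 𝕜) • 1 := by
  refine hom_ext fun d v => ?_
  have h := congrArg (fun a => ρ a v) (gen_mul_gen_add (𝕜 := 𝕜) i j)
  simp only [map_add, map_mul, AlgHom.commutes, LinearMap.add_apply, Module.End.mul_apply,
    Module.algebraMap_end_apply] at h
  rw [LinearMap.add_apply, Module.End.mul_apply, Module.End.mul_apply, mulE_mon, mulE_mon,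
    mulE_mon, mulE_mon, ← map_add, h, map_smul, LinearMap.smul_apply, Module.End.one_apply]

theorem mulE_mulE_self (ρ : Cl 𝕜 n →ₐ[𝕜] Module.End 𝕜 V) (i : Fin n)
    (f : MvPolynomial (Fin n) 𝕜 ⊗[𝕜] V) : mulE ρ i (mulE ρ i f) = -f := by
  have h := LinearMap.congr_fun (mulE_mulE_add ρ i i) f
  rw [if_pos rfl, LinearMap.add_apply, ← two_smul 𝕜, LinearMap.smul_apply, neg_smul,
    ← smul_neg] at h
  exact smul_right_injective _ (two_ne_zero (α := 𝕜)) h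

theorem mulE_mulE_of_ne (ρ : Cl 𝕜 n →ₐ[𝕜] Module.End 𝕜 V) {i j : Fin n} (h : i ≠ j)
    (f : MvPolynomial (Fin n) 𝕜 ⊗[𝕜] V) :
    mulE ρ i (mulE ρ j f) = -mulE ρ j (mulE ρ i f) := by
  have := LinearMap.congr_fun (mulE_mulE_add ρ i j) f
  rw [if_neg h, zero_smul] at this
  exact eq_neg_of_add_eq_zero_left this

end Monomials

end DunklDirac

namespace DunklDirac

/-! ### Homogeneous polynomials in a subset of the variables. -/

section Graded

variable {𝕜 : Type*} [RCLike 𝕜] {n : ℕ} {V : Type*} [AddCommGroup V] [Module 𝕜 V]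

/-- The `V`-valued homogeneous polynomials of degree `k` in the variables `xᵢ`, `i ∈ A`. -/
noncomputable def polys (𝕜 : Type*) [RCLike 𝕜] {n : ℕ} (V : Type*) [AddCommGroup V] [Module 𝕜 V]
    (A : Finset (Fin n)) (k : ℕ) : Submodule 𝕜 (MvPolynomial (Fin n) 𝕜 ⊗[𝕜] V) :=
  Submodule.span 𝕜 {f | ∃ d v, (∀ i ∉ A, d i = 0) ∧ ∑ i, d i = k ∧ mon 𝕜 d v = f}

theorem mon_mem_polys {A : Finset (Fin n)} {k : ℕ} {d : Fin n →₀ ℕ} (hA : ∀ i ∉ A, d i = 0)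
    (hk : ∑ i, d i = k) (v : V) : mon 𝕜 d v ∈ polys 𝕜 V A k :=
  Submodule.subset_span ⟨d, v, hA, hk, rfl⟩

theorem map_mem_of_mem_polys {W : Type*} [AddCommGroup W] [Module 𝕜 W] {A : Finset (Fin n)}
    {k : ℕ} {L : MvPolynomial (Fin n) 𝕜 ⊗[𝕜] V →ₗ[𝕜] W} {M : Submodule 𝕜 W}
    (h : ∀ d v, (∀ i ∉ A, d i = 0) → ∑ i, d i = k → L (mon 𝕜 d v) ∈ M)
    {f : MvPolynomial (Fin n) 𝕜 ⊗[𝕜] V} (hf : f ∈ polys 𝕜 V A k) : L f ∈ M := by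
  have : polys 𝕜 V A k ≤ M.comap L := Submodule.span_le.mpr fun _ ⟨d, v, hA, hk, e⟩ => by
    subst e
    exact h d v hA hk
  exact this hf

theorem eq_of_mem_polys {W : Type*} [AddCommGroup W] [Module 𝕜 W] {A : Finset (Fin n)}
    {k : ℕ} {L L' : MvPolynomial (Fin n) 𝕜 ⊗[𝕜] V →ₗ[𝕜] W}
    (h : ∀ d v, (∀ i ∉ A, d i = 0) → ∑ i, d i = k → L (mon 𝕜 d v) = L' (mon 𝕜 d v))
    {f : MvPolynomial (Fin n) 𝕜 ⊗[𝕜] V} (hf : f ∈ polys 𝕜 V A k) : L f = L' f := by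
  have := map_mem_of_mem_polys (L := L - L') (M := ⊥) (fun d v hA hk => by
    rw [Submodule.mem_bot, LinearMap.sub_apply, h d v hA hk, sub_self]) hf
  rwa [Submodule.mem_bot, LinearMap.sub_apply, sub_eq_zero] at this

theorem polys_mono {A B : Finset (Fin n)} (h : A ⊆ B) (k : ℕ) : polys 𝕜 V A k ≤ polys 𝕜 V B k :=
  fun _ hf => map_mem_of_mem_polys (L := LinearMap.id)
    (fun _ v hA hk => mon_mem_polys (fun i hi => hA i fun hi' => hi (h hi')) hk v) hf

theorem homogeneousV_eq_polys (k : ℕ) :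
    homogeneousV (𝕜 := 𝕜) n V k = polys 𝕜 V Finset.univ k := by
  apply le_antisymm
  · rintro _ ⟨t, rfl⟩
    induction t with
    | zero => simp
    | add x y hx hy => rw [map_add]; exact add_mem hx hy
    | tmul p v =>
      obtain ⟨p, hp⟩ := p
      change p ⊗ₜ v ∈ _
      rw [p.as_sum, TensorProduct.sum_tmul]
      refine sum_mem fun d hd => ?_
      have hdk : ∑ i, d i = k := by
        have := hp (MvPolynomial.mem_support_iff.mp hd)
        rw [Finsupp.weight_apply, Finsupp.sum_fintype _ _ (by simp)] at this
        simpa using this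
      have : MvPolynomial.monomial d (p.coeff d) = p.coeff d • MvPolynomial.monomial d 1 := by
        rw [MvPolynomial.smul_monomial, smul_eq_mul, mul_one]
      rw [this, ← TensorProduct.smul_tmul']
      exact Submodule.smul_mem _ _ (mon_mem_polys (by simp) hdk v)
  · refine Submodule.span_le.mpr ?_
    rintro _ ⟨d, v, -, hk, rfl⟩
    refine ⟨⟨MvPolynomial.monomial d 1, ?_⟩ ⊗ₜ v, rfl⟩
    refine MvPolynomial.isHomogeneous_monomial _ ?_
    rw [← hk, Finsupp.degree_eq_sum]

theorem sum_add_single (d : Fin n →₀ ℕ) (i : Fin n) (r : ℕ) :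
    ∑ k, (d + Finsupp.single i r) k = ∑ k, d k + r := by
  simp [Finset.sum_add_distrib, Finsupp.single_apply]

theorem sum_tsub_single_add_one {d : Fin n →₀ ℕ} {i : Fin n} (h : d i ≠ 0) :
    ∑ k, (d - Finsupp.single i 1 : Fin n →₀ ℕ) k + 1 = ∑ k, d k := by
  rw [← sum_add_single, single_one_add_tsub h]

section Membership

variable {A : Finset (Fin n)} {k : ℕ} {f : MvPolynomial (Fin n) 𝕜 ⊗[𝕜] V}

theorem mulX_mem {i : Fin n} (hi : i ∈ A) (hf : f ∈ polys 𝕜 V A k) :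
    mulX V i f ∈ polys 𝕜 V A (k + 1) :=
  map_mem_of_mem_polys (fun d v hA hk => by
    rw [mulX_mon]
    refine mon_mem_polys (fun j hj => ?_) (by rw [sum_add_single, hk]) v
    have : i ≠ j := fun h => hj (h ▸ hi)
    simp [hA j hj, this]) hf

theorem mulE_mem (ρ : Cl 𝕜 n →ₐ[𝕜] Module.End 𝕜 V) (i : Fin n) (hf : f ∈ polys 𝕜 V A k) :
    mulE ρ i f ∈ polys 𝕜 V A k :=
  map_mem_of_mem_polys (fun d v hA hk => by
    rw [mulE_mon]
    exact mon_mem_polys hA hk _) hf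

theorem dunklV_mem (μ : Fin n → ℝ) (i : Fin n) (hf : f ∈ polys 𝕜 V A (k + 1)) :
    dunklV V μ i f ∈ polys 𝕜 V A k :=
  map_mem_of_mem_polys (fun d v hA hk => by
    rw [dunklV_mon]
    by_cases hd : d i = 0
    · simp [hd]
    refine Submodule.smul_mem _ _ (mon_mem_polys (fun j hj => by simp [hA j hj]) ?_ v)
    have := sum_tsub_single_add_one hd
    omega) hf

theorem dunklV_eq_zero (μ : Fin n → ℝ) {i : Fin n} (hi : i ∉ A) (hf : f ∈ polys 𝕜 V A k) :
    dunklV V μ i f = 0 :=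
  eq_of_mem_polys (L' := 0) (fun d v hA hk => by simp [hA i hi]) hf

theorem dunklV_eq_zero_of_degree_zero (μ : Fin n → ℝ) (i : Fin n) (hf : f ∈ polys 𝕜 V A 0) :
    dunklV V μ i f = 0 :=
  eq_of_mem_polys (L' := 0) (fun d v hA hk => by
    have : d i = 0 := Finset.sum_eq_zero_iff.mp hk i (Finset.mem_univ i)
    simp [this]) hf

theorem restrictZero_mem (j : Fin n) (hf : f ∈ polys 𝕜 V A k) :
    restrictZero 𝕜 V j f ∈ polys 𝕜 V (A.erase j) k :=
  map_mem_of_mem_polys (fun d v hA hk => by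
    rw [restrictZero_mon]
    split_ifs with h
    · refine mon_mem_polys (fun i hi => ?_) hk v
      by_cases hij : i = j
      · rw [hij, h]
      · exact hA i fun hi' => hi (Finset.mem_erase.mpr ⟨hij, hi'⟩)
    · exact zero_mem _) hf

theorem restrictZero_eq_self {j : Fin n} (hj : j ∉ A) (hf : f ∈ polys 𝕜 V A k) :
    restrictZero 𝕜 V j f = f :=
  eq_of_mem_polys (L' := LinearMap.id) (fun d v hA hk => by simp [hA j hj]) hf

theorem dirac_apply (ρ : Cl 𝕜 n →ₐ[𝕜] Module.End 𝕜 V) (μ : Fin n → ℝ) (A : Finset (Fin n))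
    (f : MvPolynomial (Fin n) 𝕜 ⊗[𝕜] V) :
    dirac ρ μ A f = ∑ i ∈ A, mulE ρ i (dunklV V μ i f) := by
  simp [dirac, LinearMap.sum_apply]

theorem position_apply (ρ : Cl 𝕜 n →ₐ[𝕜] Module.End 𝕜 V) (A : Finset (Fin n))
    (f : MvPolynomial (Fin n) 𝕜 ⊗[𝕜] V) :
    position ρ A f = ∑ i ∈ A, mulE ρ i (mulX V i f) := by
  simp [position, LinearMap.sum_apply]

theorem dirac_mem (ρ : Cl 𝕜 n →ₐ[𝕜] Module.End 𝕜 V) (μ : Fin n → ℝ) (B : Finset (Fin n))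
    (hf : f ∈ polys 𝕜 V A (k + 1)) : dirac ρ μ B f ∈ polys 𝕜 V A k := by
  rw [dirac_apply]
  exact sum_mem fun i _ => mulE_mem ρ i (dunklV_mem μ i hf)

theorem dirac_eq_zero (ρ : Cl 𝕜 n →ₐ[𝕜] Module.End 𝕜 V) (μ : Fin n → ℝ) (B : Finset (Fin n))
    (hf : f ∈ polys 𝕜 V A 0) : dirac ρ μ B f = 0 := by
  rw [dirac_apply]
  exact Finset.sum_eq_zero fun i _ => by rw [dunklV_eq_zero_of_degree_zero μ i hf, map_zero]

theorem position_mem (ρ : Cl 𝕜 n →ₐ[𝕜] Module.End 𝕜 V) (hf : f ∈ polys 𝕜 V A k) :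
    position ρ A f ∈ polys 𝕜 V A (k + 1) := by
  rw [position_apply]
  exact sum_mem fun i hi => mulE_mem ρ i (mulX_mem hi hf)

end Membership

/-- Off-diagonal terms cancel: `eᵢ` and `eⱼ` anticommute while `xᵢ` and `Tⱼ` commute. The diagonal
ones give `2 dᵢ + 1 + 2 μᵢ` on a monomial, and the exponents over `A` add up to `k`. -/
theorem position_dirac_add (ρ : Cl 𝕜 n →ₐ[𝕜] Module.End 𝕜 V) (μ : Fin n → ℝ)
    {A : Finset (Fin n)} {k : ℕ} {f : MvPolynomial (Fin n) 𝕜 ⊗[𝕜] V} (hf : f ∈ polys 𝕜 V A k) :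
    position ρ A (dirac ρ μ A f) + dirac ρ μ A (position ρ A f) =
      -(((2 * k + ∑ i ∈ A, (1 + 2 * μ i) : ℝ) : 𝕜) • f) := by
  have key : ∀ i ∈ A, ∀ j ∈ A,
      mulE ρ i (mulX V i (mulE ρ j (dunklV V μ j f))) +
        mulE ρ j (dunklV V μ j (mulE ρ i (mulX V i f))) =
      if i = j then -(mulX V i (dunklV V μ i f) + dunklV V μ i (mulX V i f)) else 0 := by
    intro i _ j _
    have h1 : mulX V i (mulE ρ j (dunklV V μ j f)) = mulE ρ j (mulX V i (dunklV V μ j f)) :=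
      (LinearMap.congr_fun (mulE_mulX ρ j i) _).symm
    have h2 : dunklV V μ j (mulE ρ i (mulX V i f)) = mulE ρ i (dunklV V μ j (mulX V i f)) :=
      (LinearMap.congr_fun (mulE_dunklV ρ μ i j) _).symm
    rw [h1, h2]
    split_ifs with h
    · subst h
      rw [mulE_mulE_self, mulE_mulE_self, neg_add]
    · have h3 : dunklV V μ j (mulX V i f) = mulX V i (dunklV V μ j f) :=
        LinearMap.congr_fun (dunklV_mulX μ (Ne.symm h)) f
      rw [mulE_mulE_of_ne ρ h, h3, neg_add_cancel]
  have euler : ∑ i ∈ A, (mulX V i (dunklV V μ i f) + dunklV V μ i (mulX V i f)) =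
      ((2 * k + ∑ i ∈ A, (1 + 2 * μ i) : ℝ) : 𝕜) • f := by
    have := eq_of_mem_polys (L := ∑ i ∈ A, (mulX V i * dunklV V μ i + dunklV V μ i * mulX V i))
      (L' := ((2 * k + ∑ i ∈ A, (1 + 2 * μ i) : ℝ) : 𝕜) • LinearMap.id) (fun d v hA hk => ?_) hf
    · simpa only [LinearMap.sum_apply, LinearMap.add_apply, Module.End.mul_apply,
        LinearMap.smul_apply, LinearMap.id_apply] using this
    · simp only [LinearMap.sum_apply, LinearMap.add_apply, Module.End.mul_apply,
        LinearMap.smul_apply, LinearMap.id_apply, mulX_dunklV_add]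
      rw [← Finset.sum_smul]
      congr 1
      have : (k : 𝕜) = ∑ i ∈ A, (d i : 𝕜) := by
        rw [← hk, Nat.cast_sum]
        exact (Finset.sum_subset (Finset.subset_univ A) fun i _ hi => by simp [hA i hi]).symm
      push_cast
      rw [this, Finset.mul_sum, ← Finset.sum_add_distrib]
      exact Finset.sum_congr rfl fun i _ => by ring
  rw [← euler]
  simp only [position_apply, dirac_apply, map_sum]
  rw [Finset.sum_comm, ← Finset.sum_add_distrib, ← Finset.sum_neg_distrib]
  refine Finset.sum_congr rfl fun i hi => ?_
  rw [← Finset.sum_add_distrib, Finset.sum_congr rfl (key i hi), Finset.sum_ite_eq, if_pos hi]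

end Graded

/-! ### Abstract Fischer decomposition for a graded `osp(1|2)` pair. -/

section Fischer

variable {𝕜 : Type*} [RCLike 𝕜] {E : Type*} [AddCommGroup E] [Module 𝕜 E]
  {H : ℕ → Submodule 𝕜 E} {x D : Module.End 𝕜 E} {δ : ℝ}

theorem pow_mem_graded (hx : ∀ k, ∀ f ∈ H k, x f ∈ H (k + 1)) {k : ℕ} {f : E} (hf : f ∈ H k)
    (a : ℕ) : (x ^ a) f ∈ H (k + a) := by
  induction a with
  | zero => exact hf
  | succ a ih => rw [pow_succ', Module.End.mul_apply]; exact hx _ _ ih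

/-- If `x` and `D` generate `osp(1|2)`, then `D` lowers `x ^ (a + 1) m` to a nonzero multiple of
`x ^ a m` for `m` in the kernel of `D`. -/
theorem exists_lowering_coeff (hδ : 0 < δ) (hx : ∀ k, ∀ f ∈ H k, x f ∈ H (k + 1))
    (hxD : ∀ k, ∀ f ∈ H k, x (D f) + D (x f) = -(((2 * k + δ : ℝ) : 𝕜) • f)) (a k : ℕ) :
    ∃ c : 𝕜, c ≠ 0 ∧ ∀ m ∈ LinearMap.ker D ⊓ H k, D ((x ^ (a + 1)) m) = c • (x ^ a) m := by
  -- If `x D` acts on `x ^ a m` by a scalar, the anticommutator relation in degree `k + a` gives `D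
  -- x` on it.
  have step : ∀ (a : ℕ) (c : ℝ),
      (∀ m ∈ LinearMap.ker D ⊓ H k, x (D ((x ^ a) m)) = (c : 𝕜) • (x ^ a) m) →
      ∀ m ∈ LinearMap.ker D ⊓ H k,
        D ((x ^ (a + 1)) m) = ((-(2 * (k + a) + δ) - c : ℝ) : 𝕜) • (x ^ a) m := by
    intro a c h m hm
    have := hxD _ _ (pow_mem_graded hx hm.2 a)
    rw [h m hm, ← Module.End.mul_apply x, ← pow_succ'] at this
    rw [eq_sub_of_add_eq' this, RCLike.ofReal_sub, sub_smul, RCLike.ofReal_neg, neg_smul,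
      Nat.cast_add]
  have lift : ∀ (a : ℕ) (c : ℝ),
      (∀ m ∈ LinearMap.ker D ⊓ H k, D ((x ^ (a + 1)) m) = (c : 𝕜) • (x ^ a) m) →
      ∀ m ∈ LinearMap.ker D ⊓ H k,
        x (D ((x ^ (a + 1)) m)) = (c : 𝕜) • (x ^ (a + 1)) m := by
    intro a c h m hm
    rw [h m hm, map_smul, pow_succ', Module.End.mul_apply]
  -- Two steps raise the `x D` eigenvalue from `-2s` to `-2(s + 1)`; the coefficients depend on
  -- parity, and neither one vanishes.
  have rest : ∀ s : ℕ, (∀ m ∈ LinearMap.ker D ⊓ H k,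
      x (D ((x ^ (2 * s)) m)) = ((-(2 * s) : ℝ) : 𝕜) • (x ^ (2 * s)) m) →
      (∀ m ∈ LinearMap.ker D ⊓ H k,
        D ((x ^ (2 * s + 1)) m) = ((-(2 * (k + s) + δ) : ℝ) : 𝕜) • (x ^ (2 * s)) m) ∧
      ∀ m ∈ LinearMap.ker D ⊓ H k,
        D ((x ^ (2 * s + 2)) m) = ((-(2 * (s + 1)) : ℝ) : 𝕜) • (x ^ (2 * s + 1)) m := by
    intro s h
    have h1 := step _ _ h
    have e1 : -(2 * ((k : ℝ) + (2 * s : ℕ)) + δ) - -(2 * s) = -(2 * (k + s) + δ) := by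
      push_cast; ring
    rw [e1] at h1
    have h2 := step _ _ (lift _ _ h1)
    have e2 : -(2 * ((k : ℝ) + (2 * s + 1 : ℕ)) + δ) - -(2 * (k + s) + δ) =
        -(2 * (s + 1)) := by
      push_cast; ring
    rw [e2] at h2
    exact ⟨h1, h2⟩
  have even : ∀ s : ℕ, ∀ m ∈ LinearMap.ker D ⊓ H k,
      x (D ((x ^ (2 * s)) m)) = ((-(2 * s) : ℝ) : 𝕜) • (x ^ (2 * s)) m := by
    intro s
    induction s with
    | zero =>
      intro m hm
      have : D m = 0 := hm.1
      simp [this]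
    | succ s ih =>
      have := lift _ _ (rest s ih).2
      rw [Nat.cast_succ]
      exact this
  rcases Nat.even_or_odd' a with ⟨s, rfl | rfl⟩
  · refine ⟨_, ?_, (rest s (even s)).1⟩
    have : (-(2 * (k + s) + δ) : ℝ) ≠ 0 := by
      have : (0 : ℝ) < 2 * (k + s) + δ := by positivity
      linarith
    exact_mod_cast this
  · refine ⟨_, ?_, (rest s (even s)).2⟩
    have : (-(2 * (s + 1)) : ℝ) ≠ 0 := by
      have : (0 : ℝ) < 2 * (s + 1) := by positivity
      linarith
    exact_mod_cast this

theorem sum_antidiagonal_pow_succ (m : ℕ × ℕ → E) (k : ℕ) :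
    ∑ p ∈ antidiagonal (k + 1), (x ^ p.1) (m p) =
      m (0, k + 1) + ∑ p ∈ antidiagonal k, (x ^ (p.1 + 1)) (m (p.1 + 1, p.2)) := by
  rw [Finset.Nat.sum_antidiagonal_succ]
  rfl

/-- Existence of the Fischer decomposition. -/
theorem exists_fischer (hδ : 0 < δ) (hx : ∀ k, ∀ f ∈ H k, x f ∈ H (k + 1))
    (hD : ∀ k, ∀ f ∈ H (k + 1), D f ∈ H k) (hD0 : ∀ f ∈ H 0, D f = 0)
    (hxD : ∀ k, ∀ f ∈ H k, x (D f) + D (x f) = -(((2 * k + δ : ℝ) : 𝕜) • f)) (k : ℕ) :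
    ∀ f ∈ H k, ∃ m : ℕ × ℕ → E, (∀ p ∈ antidiagonal k, m p ∈ LinearMap.ker D ⊓ H p.2) ∧
      f = ∑ p ∈ antidiagonal k, (x ^ p.1) (m p) := by
  induction k with
  | zero => exact fun f hf => ⟨fun _ => f, by simpa using ⟨hD0 f hf, hf⟩, by simp⟩
  | succ k ih =>
    intro f hf
    obtain ⟨m, hm, e⟩ := ih _ (hD k f hf)
    choose c hc hcm using fun p : ℕ × ℕ => exists_lowering_coeff hδ hx hxD p.1 p.2
    -- A preimage of `D f` under `D`, found by raising each component once and dividing by its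
    -- lowering coefficient; then `f - g` is the monogenic part.
    set g := ∑ p ∈ antidiagonal k, (x ^ (p.1 + 1)) ((c p)⁻¹ • m p) with hg
    have hDg : D g = D f := by
      rw [e, hg, map_sum]
      refine Finset.sum_congr rfl fun p hp => ?_
      rw [map_smul, map_smul, hcm p _ (hm p hp), smul_smul, inv_mul_cancel₀ (hc p), one_smul]
    have hgH : g ∈ H (k + 1) := by
      refine sum_mem fun p hp => ?_
      have := pow_mem_graded hx (Submodule.smul_mem _ (c p)⁻¹ (hm p hp).2) (p.1 + 1)
      rw [mem_antidiagonal] at hp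
      rwa [show p.2 + (p.1 + 1) = k + 1 by omega] at this
    refine ⟨fun p => if p.1 = 0 then f - g else (c (p.1 - 1, p.2))⁻¹ • m (p.1 - 1, p.2), ?_, ?_⟩
    · rintro ⟨a, b⟩ hp
      rw [mem_antidiagonal] at hp
      dsimp only at hp ⊢
      split_ifs with h
      · subst h
        rw [zero_add] at hp
        subst hp
        exact ⟨LinearMap.mem_ker.mpr (by rw [map_sub, hDg, sub_self]), sub_mem hf hgH⟩
      · exact Submodule.smul_mem _ _ (hm (a - 1, b) (by rw [mem_antidiagonal]; omega))
    · rw [sum_antidiagonal_pow_succ]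
      simp only [if_true, Nat.succ_ne_zero, if_false, Nat.add_sub_cancel]
      rw [← hg, sub_add_cancel]

/-- Uniqueness of the Fischer decomposition. -/
theorem fischer_unique (hδ : 0 < δ) (hx : ∀ k, ∀ f ∈ H k, x f ∈ H (k + 1))
    (hxD : ∀ k, ∀ f ∈ H k, x (D f) + D (x f) = -(((2 * k + δ : ℝ) : 𝕜) • f)) (k : ℕ) :
    ∀ m : ℕ × ℕ → E, (∀ p ∈ antidiagonal k, m p ∈ LinearMap.ker D ⊓ H p.2) →
      ∑ p ∈ antidiagonal k, (x ^ p.1) (m p) = 0 → ∀ p ∈ antidiagonal k, m p = 0 := by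
  induction k with
  | zero =>
    intro m _ h
    simpa using h
  | succ k ih =>
    intro m hm h
    choose c hc hcm using fun p : ℕ × ℕ => exists_lowering_coeff hδ hx hxD p.1 p.2
    rw [sum_antidiagonal_pow_succ] at h
    have hm' : ∀ p ∈ antidiagonal k, m (p.1 + 1, p.2) ∈ LinearMap.ker D ⊓ H p.2 :=
      fun p hp => hm (p.1 + 1, p.2) (by rw [mem_antidiagonal] at hp ⊢; dsimp only; omega)
    -- Applying `D` kills the monogenic term and leaves a relation one degree lower, with nonzero
    -- coefficients.
    have hz : ∀ p ∈ antidiagonal k, m (p.1 + 1, p.2) = 0 := by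
      have h0 := ih (fun p => c p • m (p.1 + 1, p.2))
        (fun p hp => Submodule.smul_mem _ _ (hm' p hp)) ?_
      · exact fun p hp => (smul_eq_zero.mp (h0 p hp)).resolve_left (hc p)
      · have hD := congrArg D h
        have : D (m (0, k + 1)) = 0 := (hm (0, k + 1) (by simp)).1
        rw [map_add, this, zero_add, map_sum, map_zero] at hD
        rw [← hD]
        exact Finset.sum_congr rfl fun p hp => by rw [map_smul, hcm p _ (hm' p hp)]
    rw [Finset.sum_eq_zero fun p hp => by rw [hz p hp, map_zero], add_zero] at h
    rintro ⟨a, b⟩ hp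
    rw [mem_antidiagonal] at hp
    dsimp only at hp
    cases a with
    | zero =>
      rw [zero_add] at hp
      rw [hp, h]
    | succ a => exact hz (a, b) (by rw [mem_antidiagonal]; omega)

end Fischer

end DunklDirac

namespace DunklDirac

/-! ### Cauchy--Kovalevskaia extension in one variable. -/

section Extension

variable {𝕜 : Type*} [RCLike 𝕜] {n : ℕ} {V : Type*} [AddCommGroup V] [Module 𝕜 V]
  (ρ : Cl 𝕜 n →ₐ[𝕜] Module.End 𝕜 V) (μ : Fin n → ℝ) (j : Fin n)

theorem Iic_eq_insert : Finset.Iic j = insert j (Finset.Iio j) := by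
  ext i
  simp [le_iff_eq_or_lt]

theorem Iic_erase_self : (Finset.Iic j).erase j = Finset.Iio j := by
  ext i
  simp [lt_iff_le_and_ne, and_comm]

theorem dirac_Iic (f : MvPolynomial (Fin n) 𝕜 ⊗[𝕜] V) :
    dirac ρ μ (Finset.Iic j) f =
      dirac ρ μ (Finset.Iio j) f + mulE ρ j (dunklV V μ j f) := by
  rw [dirac_apply, dirac_apply, Iic_eq_insert, Finset.sum_insert (by simp), add_comm]

/-- Only variables before `xⱼ` enter `D`. This lets `(xⱼ D) ^ r` split as `xⱼ ^ r D ^ r`. -/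
theorem commute_mulX_dirac : Commute (mulX V j) (dirac ρ μ (Finset.Iio j)) := by
  refine Commute.sum_right _ _ _ fun i hi => Commute.mul_right (mulE_mulX ρ i j).symm ?_
  exact (dunklV_mulX μ (Finset.mem_Iio.mp hi).ne).symm

theorem commute_dunklV_dirac : Commute (dunklV V μ j) (dirac ρ μ (Finset.Iio j)) := by
  refine Commute.sum_right _ _ _ fun i hi => Commute.mul_right (mulE_dunklV ρ μ i j).symm ?_
  exact dunklV_dunklV μ (Finset.mem_Iio.mp hi).ne'

theorem commute_restrictZero_dirac :
    Commute (restrictZero 𝕜 V j) (dirac ρ μ (Finset.Iio j)) := by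
  refine Commute.sum_right _ _ _ fun i hi => Commute.mul_right (mulE_restrictZero ρ i j).symm ?_
  exact (dunklV_restrictZero μ (Finset.mem_Iio.mp hi).ne).symm

theorem dirac_mulE (f : MvPolynomial (Fin n) 𝕜 ⊗[𝕜] V) :
    dirac ρ μ (Finset.Iio j) (mulE ρ j f) = -mulE ρ j (dirac ρ μ (Finset.Iio j) f) := by
  rw [dirac_apply, dirac_apply, map_sum, ← Finset.sum_neg_distrib]
  refine Finset.sum_congr rfl fun i hi => ?_
  rw [← mulE_mulE_of_ne ρ (Finset.mem_Iio.mp hi).ne]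
  exact congrArg _ (LinearMap.congr_fun (mulE_dunklV ρ μ j i) f).symm

variable {μ j} {k : ℕ} {f g : MvPolynomial (Fin n) 𝕜 ⊗[𝕜] V}

/-- A Dunkl monogenic function is determined by its restriction to `xⱼ = 0`. -/
theorem eq_zero_of_restrictZero_eq_zero (hμ : 0 < μ j)
    (hg : g ∈ polys 𝕜 V (Finset.Iic j) k) (hD : dirac ρ μ (Finset.Iic j) g = 0)
    (hR : restrictZero 𝕜 V j g = 0) : g = 0 := by
  have key : ∀ h : MvPolynomial (Fin n) 𝕜 ⊗[𝕜] V, restrictZero 𝕜 V j h = 0 →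
      dunklV V μ j h = 0 → h = 0 := by
    intro h h1 h2
    have := LinearMap.congr_fun (antiDunkl_dunklV (𝕜 := 𝕜) (V := V) hμ) h
    rw [LinearMap.add_apply, Module.End.mul_apply, h1, h2, map_zero, add_zero] at this
    exact this.symm
  -- Induction on degree through `Tⱼ g`: it is again monogenic, and since `Tⱼ g = eⱼ D g`, its
  -- restriction is `eⱼ D` of the restriction of `g`, hence zero.
  induction k generalizing g with
  | zero => exact key g hR (dunklV_eq_zero_of_degree_zero μ j hg)
  | succ k ih =>
    refine key g hR (ih (dunklV_mem μ j hg) ?_ ?_)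
    · rw [dirac_Iic] at hD ⊢
      have h1 := LinearMap.congr_fun (commute_dunklV_dirac ρ μ j) g
      have h2 := LinearMap.congr_fun (mulE_dunklV ρ μ j j) (dunklV V μ j g)
      simp only [Module.End.mul_apply] at h1 h2
      rw [← h1, h2, ← map_add, hD, map_zero]
    · have h : dunklV V μ j g = mulE ρ j (dirac ρ μ (Finset.Iio j) g) := by
        rw [dirac_Iic] at hD
        have := congrArg (mulE ρ j) hD
        rw [map_add, mulE_mulE_self, map_zero, ← sub_eq_add_neg, sub_eq_zero] at this
        exact this.symm
      have h1 := LinearMap.congr_fun (commute_restrictZero_dirac ρ μ j) g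
      have h2 := LinearMap.congr_fun (mulE_restrictZero ρ j j) (dirac ρ μ (Finset.Iio j) g)
      simp only [Module.End.mul_apply] at h1 h2
      rw [h, ← h2, h1, hR, map_zero, map_zero]

variable (𝕜 μ j) in
/-- The coefficient of `xⱼ ^ (2 l) D ^ (2 l)` in the Cauchy--Kovalevskaia operator. -/
noncomputable def evenCoeff (l : ℕ) : 𝕜 :=
  ((Real.Gamma (μ j + 1 / 2) * besselCoeff (μ j - 1 / 2) l : ℝ) : 𝕜)

variable (𝕜 μ j) in
/-- The coefficient of `eⱼ xⱼ ^ (2 l + 1) D ^ (2 l + 1)` in the Cauchy--Kovalevskaia operator. -/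
noncomputable def oddCoeff (l : ℕ) : 𝕜 :=
  ((Real.Gamma (μ j + 1 / 2) * (1 / 2 * besselCoeff (μ j + 1 / 2) l) : ℝ) : 𝕜)

/-- The prefactor `Γ(μⱼ + 1/2)` is the normalization that makes the extension restrict to its datum.
-/
theorem evenCoeff_zero (hμ : 0 < μ j) : evenCoeff 𝕜 μ j 0 = 1 := by
  have h : (Real.Gamma (μ j + 1 / 2)) ≠ 0 := (Real.Gamma_pos_of_pos (by linarith)).ne'
  have e : (0 : ℝ) + (μ j - 1 / 2) + 1 = μ j + 1 / 2 := by ring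
  simp only [evenCoeff, besselCoeff, Nat.cast_zero, e]
  simp only [mul_zero, pow_zero, Nat.factorial_zero, Nat.cast_one, one_mul]
  rw [mul_one_div_cancel h, RCLike.ofReal_one]

/-- From `Γ(s + 1) = s Γ(s)` at `s = l + μⱼ + 1/2`. This and `oddCoeff_eq`, which comes from the
factorial, are the recursions that make the extension monogenic. -/
theorem evenCoeff_eq (hμ : 0 < μ j) (l : ℕ) :
    evenCoeff 𝕜 μ j l = oddCoeff 𝕜 μ j l * dunklWeight 𝕜 (μ j) (2 * l + 1) := by
  have h : (0 : ℝ) < l + μ j + 1 / 2 := by positivity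
  have hΓ := (Real.Gamma_pos_of_pos h).ne'
  have e1 : (l : ℝ) + (μ j - 1 / 2) + 1 = l + μ j + 1 / 2 := by ring
  have e2 : (l : ℝ) + (μ j + 1 / 2) + 1 = l + μ j + 1 / 2 + 1 := by ring
  have hf : (l.factorial : ℝ) ≠ 0 := by positivity
  have : besselCoeff (μ j - 1 / 2) l =
      1 / 2 * besselCoeff (μ j + 1 / 2) l * (2 * l + 1 + 2 * μ j) := by
    rw [besselCoeff, besselCoeff, e1, e2, Real.Gamma_add_one h.ne']
    have h' : (l : ℝ) * 2 + μ j * 2 + 1 ≠ 0 := by positivity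
    field_simp
    ring
  rw [dunklWeight_odd, evenCoeff, oddCoeff, this]
  push_cast
  ring

theorem oddCoeff_eq (l : ℕ) :
    oddCoeff 𝕜 μ j l = evenCoeff 𝕜 μ j (l + 1) * dunklWeight 𝕜 (μ j) (2 * (l + 1)) := by
  have e1 : ((l + 1 : ℕ) : ℝ) + (μ j - 1 / 2) + 1 = l + (μ j + 1 / 2) + 1 := by
    push_cast; ring
  have hf : (l.factorial : ℝ) ≠ 0 := by positivity
  have h1 : (l : ℝ) + 1 ≠ 0 := by positivity
  have : 1 / 2 * besselCoeff (μ j + 1 / 2) l =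
      besselCoeff (μ j - 1 / 2) (l + 1) * (2 * (l + 1)) := by
    rw [besselCoeff, besselCoeff, e1, Nat.factorial_succ, mul_add 2 l 1, pow_add]
    push_cast
    rw [show ((2 : ℝ) ^ (2 * 1)) = 4 by norm_num]
    have h2 : (4 : ℝ) * (l + 1) ≠ 0 := by positivity
    rw [one_div, one_div, one_div, mul_inv, mul_inv, mul_inv, mul_inv, mul_inv]
    field_simp
    norm_num
  rw [dunklWeight_even, evenCoeff, oddCoeff, this]
  push_cast
  ring

theorem mulX_pow_mon (d : Fin n →₀ ℕ) (v : V) (r : ℕ) :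
    (mulX V j ^ r) (mon 𝕜 d v) = mon 𝕜 (d + Finsupp.single j r) v := by
  induction r with
  | zero => simp
  | succ r ih =>
    rw [pow_succ', Module.End.mul_apply, ih, mulX_mon, add_assoc, ← Finsupp.single_add]

theorem dunklV_mulX_pow {B : Finset (Fin n)} (hj : j ∉ B) (hf : f ∈ polys 𝕜 V B k) (r : ℕ) :
    dunklV V μ j ((mulX V j ^ (r + 1)) f) =
      dunklWeight 𝕜 (μ j) (r + 1) • (mulX V j ^ r) f :=
  eq_of_mem_polys (L := dunklV V μ j * mulX V j ^ (r + 1))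
    (L' := dunklWeight 𝕜 (μ j) (r + 1) • mulX V j ^ r) (fun d v hA hk => by
    have : d + Finsupp.single j (r + 1) - Finsupp.single j 1 = d + Finsupp.single j r := by
      rw [Finsupp.single_add, ← add_assoc, add_tsub_cancel_right]
    rw [Module.End.mul_apply, mulX_pow_mon, dunklV_mon, LinearMap.smul_apply, mulX_pow_mon, this]
    simp [hA j hj]) hf

theorem restrictZero_mulX (f : MvPolynomial (Fin n) 𝕜 ⊗[𝕜] V) :
    restrictZero 𝕜 V j (mulX V j f) = 0 := by
  have : restrictZero 𝕜 V j * mulX V j = 0 := hom_ext fun d v => by simp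
  exact LinearMap.congr_fun this f

theorem dirac_pow_eq_zero {B : Finset (Fin n)} (C : Finset (Fin n)) (hf : f ∈ polys 𝕜 V B k)
    {q : ℕ} (hq : k < q) : (dirac ρ μ C ^ q) f = 0 := by
  induction q generalizing k f with
  | zero => omega
  | succ q ih =>
    rw [pow_succ, Module.End.mul_apply]
    cases k with
    | zero => rw [dirac_eq_zero ρ μ C hf, map_zero]
    | succ k => exact ih (dirac_mem ρ μ C hf) (by omega)

theorem dirac_pow_mem {B : Finset (Fin n)} (C : Finset (Fin n)) (hf : f ∈ polys 𝕜 V B k)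
    (q : ℕ) : ∃ k', (dirac ρ μ C ^ q) f ∈ polys 𝕜 V B k' := by
  induction q generalizing k f with
  | zero => exact ⟨k, hf⟩
  | succ q ih =>
    rw [pow_succ, Module.End.mul_apply]
    cases k with
    | zero => exact ⟨0, by rw [dirac_eq_zero ρ μ C hf, map_zero]; exact zero_mem _⟩
    | succ k => exact ih (dirac_mem ρ μ C hf)

variable (μ j) in
/-- The Cauchy--Kovalevskaia operator on polynomials of degree `k`, as a finite sum. -/
noncomputable def CKSum (k : ℕ) : Module.End 𝕜 (MvPolynomial (Fin n) 𝕜 ⊗[𝕜] V) :=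
  ∑ l ∈ Finset.range (k + 1),
    (evenCoeff 𝕜 μ j l • (mulX V j ^ (2 * l) * dirac ρ μ (Finset.Iio j) ^ (2 * l)) +
      oddCoeff 𝕜 μ j l • (mulE ρ j * (mulX V j ^ (2 * l + 1) *
        dirac ρ μ (Finset.Iio j) ^ (2 * l + 1))))

theorem besselApply_eq_sum (α : ℝ) (hf : f ∈ polys 𝕜 V (Finset.Iio j) k) :
    besselApply α (mulX V j * dirac ρ μ (Finset.Iio j)) f =
      ∑ l ∈ Finset.range (k + 1), ((besselCoeff α l : ℝ) : 𝕜) •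
        (mulX V j ^ (2 * l)) ((dirac ρ μ (Finset.Iio j) ^ (2 * l)) f) := by
  rw [besselApply]
  simp only [(commute_mulX_dirac ρ μ j).mul_pow, Module.End.mul_apply]
  refine finsum_eq_sum_of_support_subset _ fun l hl => ?_
  rw [Finset.coe_range, Set.mem_Iio]
  by_contra h
  refine hl ?_
  beta_reduce
  rw [dirac_pow_eq_zero ρ _ hf (by omega), map_zero, smul_zero]

/-- `CK` is a bare function built on `finsum`; in each degree it agrees with an endomorphism, which
supplies linearity. -/
theorem CK_eq_CKSum (hf : f ∈ polys 𝕜 V (Finset.Iio j) k) :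
    CK ρ μ j f = CKSum ρ μ j k f := by
  rw [CK, besselApply_eq_sum ρ _ hf, besselApply_eq_sum ρ _ hf, CKSum]
  simp only [map_sum, LinearMap.sum_apply, Finset.smul_sum, LinearMap.add_apply,
    LinearMap.smul_apply, Module.End.mul_apply, smul_add, Finset.sum_add_distrib, map_smul,
    smul_smul, evenCoeff, oddCoeff]
  congr 1
  · push_cast
    rfl
  · refine Finset.sum_congr rfl fun l _ => ?_
    have h := LinearMap.congr_fun ((commute_mulX_dirac ρ μ j).pow_left (2 * l))
      ((dirac ρ μ (Finset.Iio j) ^ (2 * l)) f)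
    simp only [Module.End.mul_apply] at h
    rw [← h, pow_succ' (mulX V j), pow_succ' (dirac ρ μ (Finset.Iio j)), Module.End.mul_apply,
      Module.End.mul_apply]
    push_cast
    rfl

theorem mulX_pow_dirac_pow_mem (hf : f ∈ polys 𝕜 V (Finset.Iic j) k) (r : ℕ) :
    (mulX V j ^ r) ((dirac ρ μ (Finset.Iio j) ^ r) f) ∈ polys 𝕜 V (Finset.Iic j) k := by
  rw [← Module.End.mul_apply, ← (commute_mulX_dirac ρ μ j).mul_pow]
  induction r with
  | zero => exact hf
  | succ r ih =>
    rw [pow_succ', Module.End.mul_apply, Module.End.mul_apply]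
    cases k with
    | zero => rw [dirac_eq_zero ρ μ _ ih, map_zero]; exact zero_mem _
    | succ k => exact mulX_mem (by simp) (dirac_mem ρ μ _ ih)

theorem CK_mem_polys (hf : f ∈ polys 𝕜 V (Finset.Iio j) k) :
    CK ρ μ j f ∈ polys 𝕜 V (Finset.Iic j) k := by
  have h := polys_mono Finset.Iio_subset_Iic_self k hf
  rw [CK_eq_CKSum ρ hf, CKSum, LinearMap.sum_apply]
  refine sum_mem fun l _ => ?_
  simp only [LinearMap.add_apply, LinearMap.smul_apply, Module.End.mul_apply]
  exact add_mem (Submodule.smul_mem _ _ (mulX_pow_dirac_pow_mem ρ h _))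
    (Submodule.smul_mem _ _ (mulE_mem ρ j (mulX_pow_dirac_pow_mem ρ h _)))

theorem restrictZero_CK (hμ : 0 < μ j) (hf : f ∈ polys 𝕜 V (Finset.Iio j) k) :
    restrictZero 𝕜 V j (CK ρ μ j f) = f := by
  have h : ∀ g, restrictZero 𝕜 V j (mulE ρ j (mulX V j g)) = 0 := fun g => by
    have := LinearMap.congr_fun (mulE_restrictZero ρ j j) (mulX V j g)
    rw [Module.End.mul_apply, Module.End.mul_apply, restrictZero_mulX, map_zero] at this
    exact this.symm
  rw [CK_eq_CKSum ρ hf, CKSum, LinearMap.sum_apply, map_sum, Finset.sum_range_succ',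
    Finset.sum_eq_zero]
  · simp only [LinearMap.add_apply, LinearMap.smul_apply, Module.End.mul_apply, map_add, map_smul,
      evenCoeff_zero hμ, mul_zero, pow_zero, Module.End.one_apply, zero_add, pow_one, h, smul_zero,
      add_zero, one_smul]
    exact restrictZero_eq_self (by simp) hf
  · intro l _
    simp only [LinearMap.add_apply, LinearMap.smul_apply, Module.End.mul_apply, map_add, map_smul,
      pow_succ' (mulX V j), mul_add 2 l 1, h, restrictZero_mulX, smul_zero, add_zero]

/-- `D` of the even term cancels `eⱼ Tⱼ` of the odd term with the same `l`; `eⱼ Tⱼ` of the even term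
and `D` of the odd term telescope. -/
theorem dirac_CK (hμ : 0 < μ j) (hf : f ∈ polys 𝕜 V (Finset.Iio j) k) :
    dirac ρ μ (Finset.Iic j) (CK ρ μ j f) = 0 := by
  set D := dirac ρ μ (Finset.Iio j) with hDdef
  have hDX : ∀ r g, D ((mulX V j ^ r) g) = (mulX V j ^ r) (D g) := fun r g =>
    (LinearMap.congr_fun ((commute_mulX_dirac ρ μ j).pow_left r) g).symm
  have hT : ∀ r q, dunklV V μ j ((mulX V j ^ (r + 1)) ((D ^ q) f)) =
      dunklWeight 𝕜 (μ j) (r + 1) • (mulX V j ^ r) ((D ^ q) f) := fun r q => by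
    obtain ⟨k', h⟩ := dirac_pow_mem ρ (Finset.Iio j) hf q
    exact dunklV_mulX_pow (by simp) h r
  have hTe : ∀ g, dunklV V μ j (mulE ρ j g) = mulE ρ j (dunklV V μ j g) := fun g =>
    (LinearMap.congr_fun (mulE_dunklV ρ μ j j) g).symm
  -- At `l = 0` the truncated exponent `2 * l - 1` is harmless, because the weight is zero there.
  let s : ℕ → MvPolynomial (Fin n) 𝕜 ⊗[𝕜] V := fun l =>
    (evenCoeff 𝕜 μ j l * dunklWeight 𝕜 (μ j) (2 * l)) •
      mulE ρ j ((mulX V j ^ (2 * l - 1)) ((D ^ (2 * l)) f))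
  have hs0 : s 0 = 0 := by simp [s]
  -- The upper end vanishes because `D ^ (2 * (k + 1))` exceeds the degree of `f`.
  have hsk : s (k + 1) = 0 := by
    simp only [s]
    rw [dirac_pow_eq_zero ρ _ hf (by omega), map_zero, map_zero, smul_zero]
  have hs : ∀ l, mulE ρ j (dunklV V μ j (evenCoeff 𝕜 μ j l •
      (mulX V j ^ (2 * l)) ((D ^ (2 * l)) f))) = s l := by
    intro l
    cases l with
    | zero => simp [hs0, dunklV_eq_zero μ (i := j) (by simp) hf]
    | succ l =>
      rw [map_smul, map_smul, show 2 * (l + 1) = (2 * l + 1) + 1 by ring, hT, map_smul, smul_smul]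
      rfl
  have hs' : ∀ l, D (oddCoeff 𝕜 μ j l • mulE ρ j ((mulX V j ^ (2 * l + 1))
      ((D ^ (2 * l + 1)) f))) = -s (l + 1) := by
    intro l
    rw [map_smul, hDdef, dirac_mulE, ← hDdef, hDX, oddCoeff_eq, smul_neg, ← Module.End.mul_apply D,
      ← pow_succ']
    rfl
  have hcancel : ∀ l, D (evenCoeff 𝕜 μ j l • (mulX V j ^ (2 * l)) ((D ^ (2 * l)) f)) +
      mulE ρ j (dunklV V μ j (oddCoeff 𝕜 μ j l • mulE ρ j ((mulX V j ^ (2 * l + 1))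
        ((D ^ (2 * l + 1)) f)))) = 0 := by
    intro l
    rw [map_smul, map_smul, map_smul, hTe, mulE_mulE_self, hT, hDX, ← Module.End.mul_apply D,
      ← pow_succ', evenCoeff_eq hμ, smul_neg, smul_smul, add_neg_cancel]
  rw [dirac_Iic, CK_eq_CKSum ρ hf, CKSum, LinearMap.sum_apply, map_sum, map_sum, map_sum,
    ← Finset.sum_add_distrib]
  have hterm : ∀ l, _ := fun l => congrArg₂ (· + ·) (hcancel l) (congrArg₂ (· + ·) (hs l) (hs' l))
  trans s 0 - s (k + 1)
  swap
  · rw [hs0, hsk, sub_zero]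
  rw [← Finset.sum_range_sub']
  refine Finset.sum_congr rfl fun l _ => ?_
  rw [sub_eq_add_neg, ← zero_add (s l + -s (l + 1)), ← hterm l]
  simp only [LinearMap.add_apply, LinearMap.smul_apply, Module.End.mul_apply, map_add]
  abel

/-- Both sides are monogenic with the same restriction. -/
theorem CK_restrictZero (hμ : 0 < μ j) (hg : g ∈ polys 𝕜 V (Finset.Iic j) k)
    (hD : dirac ρ μ (Finset.Iic j) g = 0) : CK ρ μ j (restrictZero 𝕜 V j g) = g := by
  have hR := Iic_erase_self j ▸ restrictZero_mem j hg
  rw [← sub_eq_zero]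
  refine eq_zero_of_restrictZero_eq_zero ρ hμ (sub_mem (CK_mem_polys ρ hR) hg) ?_ ?_
  · rw [map_sub, hD, dirac_CK ρ hμ hR, sub_zero]
  · rw [map_sub, restrictZero_CK ρ hμ hR, sub_self]

end Extension

end DunklDirac

namespace DunklDirac

/-! ### Linearity of the extension; Fischer decomposition for Dunkl operators. -/

section Linearity

variable {𝕜 : Type*} [RCLike 𝕜] {n : ℕ} {V : Type*} [AddCommGroup V] [Module 𝕜 V]
  (ρ : Cl 𝕜 n →ₐ[𝕜] Module.End 𝕜 V) {μ : Fin n → ℝ} {j : Fin n} {k : ℕ}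

theorem CK_sum {ι : Type*} (s : Finset ι) {F : ι → MvPolynomial (Fin n) 𝕜 ⊗[𝕜] V}
    (hF : ∀ t ∈ s, F t ∈ polys 𝕜 V (Finset.Iio j) k) :
    CK ρ μ j (∑ t ∈ s, F t) = ∑ t ∈ s, CK ρ μ j (F t) := by
  rw [CK_eq_CKSum ρ (sum_mem hF), map_sum]
  exact Finset.sum_congr rfl fun t ht => (CK_eq_CKSum ρ (hF t ht)).symm

theorem CK_add {f g : MvPolynomial (Fin n) 𝕜 ⊗[𝕜] V} (hf : f ∈ polys 𝕜 V (Finset.Iio j) k)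
    (hg : g ∈ polys 𝕜 V (Finset.Iio j) k) : CK ρ μ j (f + g) = CK ρ μ j f + CK ρ μ j g := by
  rw [CK_eq_CKSum ρ (add_mem hf hg), CK_eq_CKSum ρ hf, CK_eq_CKSum ρ hg, map_add]

theorem CK_smul {f : MvPolynomial (Fin n) 𝕜 ⊗[𝕜] V} (c : 𝕜)
    (hf : f ∈ polys 𝕜 V (Finset.Iio j) k) : CK ρ μ j (c • f) = c • CK ρ μ j f := by
  rw [CK_eq_CKSum ρ (Submodule.smul_mem _ c hf), CK_eq_CKSum ρ hf, map_smul]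

theorem position_pow_mem {A : Finset (Fin n)} {f : MvPolynomial (Fin n) 𝕜 ⊗[𝕜] V}
    (hf : f ∈ polys 𝕜 V A k) (a : ℕ) : (position ρ A ^ a) f ∈ polys 𝕜 V A (k + a) :=
  pow_mem_graded (H := polys 𝕜 V A) (fun _ _ => position_mem ρ) hf a

theorem exists_fischer_polys {A : Finset (Fin n)} (hA : 0 < ∑ r ∈ A, (1 + 2 * μ r))
    {f : MvPolynomial (Fin n) 𝕜 ⊗[𝕜] V} (hf : f ∈ polys 𝕜 V A k) :
    ∃ M : ℕ × ℕ → MvPolynomial (Fin n) 𝕜 ⊗[𝕜] V,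
      (∀ p ∈ antidiagonal k, M p ∈ LinearMap.ker (dirac ρ μ A) ⊓ polys 𝕜 V A p.2) ∧
      f = ∑ p ∈ antidiagonal k, (position ρ A ^ p.1) (M p) := by
  refine exists_fischer (H := polys 𝕜 V A) hA ?_ ?_ ?_ ?_ k f hf
  · exact fun k g hg => position_mem ρ hg
  · exact fun k g hg => dirac_mem ρ μ A hg
  · exact fun g hg => dirac_eq_zero ρ μ A hg
  · exact fun k g hg => position_dirac_add ρ μ hg

theorem fischer_polys_unique {A : Finset (Fin n)} (hA : 0 < ∑ r ∈ A, (1 + 2 * μ r))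
    {M : ℕ × ℕ → MvPolynomial (Fin n) 𝕜 ⊗[𝕜] V}
    (hM : ∀ p ∈ antidiagonal k, M p ∈ LinearMap.ker (dirac ρ μ A) ⊓ polys 𝕜 V A p.2)
    (h : ∑ p ∈ antidiagonal k, (position ρ A ^ p.1) (M p) = 0) :
    ∀ p ∈ antidiagonal k, M p = 0 := by
  refine fischer_unique (H := polys 𝕜 V A) (D := dirac ρ μ A) hA ?_ ?_ k M hM h
  · exact fun k g hg => position_mem ρ hg
  · exact fun k g hg => position_dirac_add ρ μ hg

end Linearity

/-! ### Nested extensions and their sums. -/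

section Nested

variable {𝕜 : Type*} [RCLike 𝕜] {m : ℕ} {V : Type*} [AddCommGroup V] [Module 𝕜 V]
  (ρ : Cl 𝕜 (m + 2) →ₐ[𝕜] Module.End 𝕜 V) {μ : Fin (m + 2) → ℝ}

theorem Iio_succ_succ (i : Fin m) :
    Finset.Iio i.succ.succ = Finset.Iic (i.castSucc.succ : Fin (m + 2)) := by
  ext a
  simp [Fin.lt_def, Fin.le_def]

theorem Iic_succ_eq_insert (i : Fin m) :
    Finset.Iic i.succ = insert i.succ (Finset.Iic i.castSucc) := by
  ext a
  simp only [Finset.mem_Iic, Finset.mem_insert, Fin.le_def, Fin.ext_iff, Fin.val_succ,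
    Fin.val_castSucc]
  omega

theorem sum_Iic_succ {M : Type*} [AddCommMonoid M] (j : Fin (m + 1) → M) (i : Fin m) :
    ∑ r ∈ Finset.Iic i.succ, j r = ∑ r ∈ Finset.Iic i.castSucc, j r + j i.succ := by
  rw [Iic_succ_eq_insert, Finset.sum_insert (by simp), add_comm]

theorem X_pow_tmul (k : ℕ) (v : V) :
    ((MvPolynomial.X 0 : MvPolynomial (Fin (m + 2)) 𝕜) ^ k) ⊗ₜ[𝕜] v =
      mon 𝕜 (Finsupp.single 0 k) v := by
  rw [MvPolynomial.X_pow_eq_monomial, mon_apply]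

theorem mon_single_zero_mem (k : ℕ) (v : V) :
    mon 𝕜 (Finsupp.single 0 k) v ∈ polys 𝕜 V (Finset.Iio (1 : Fin (m + 2))) k := by
  refine mon_mem_polys (fun i hi => ?_) (by simp [Finsupp.single_apply]) v
  refine Finsupp.single_eq_of_ne fun h => hi ?_
  rw [h]
  simp

theorem nested_zero (j : Fin (m + 1) → ℕ) (v : V) :
    nested ρ μ j v 0 = CK ρ μ 1 (mon 𝕜 (Finsupp.single 0 (j 0)) v) := by
  rw [← X_pow_tmul]
  rfl

theorem nested_succ (j : Fin (m + 1) → ℕ) (v : V) (i : Fin m) :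
    nested ρ μ j v i.succ = CK ρ μ i.succ.succ
      ((position ρ (Finset.Iic i.castSucc.succ) ^ j i.succ) (nested ρ μ j v i.castSucc)) := by
  rw [← Iio_succ_succ]
  rfl

/-- Stage `i` reads no exponent beyond `i`, so the last exponent can be split off in
`nestedSum_succ`. -/
theorem nested_congr {j j' : Fin (m + 1) → ℕ} (v : V) (i : Fin (m + 1))
    (h : ∀ r ≤ i, j r = j' r) : nested ρ μ j v i = nested ρ μ j' v i := by
  induction i using Fin.induction with
  | zero => rw [nested_zero, nested_zero, h 0 le_rfl]
  | succ i ih =>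
    rw [nested_succ, nested_succ, h _ le_rfl,
      ih fun r hr => h r (hr.trans i.castSucc_lt_succ.le)]

theorem nested_mem_polys (j : Fin (m + 1) → ℕ) (v : V) (i : Fin (m + 1)) :
    nested ρ μ j v i ∈ polys 𝕜 V (Finset.Iic i.succ) (∑ r ∈ Finset.Iic i, j r) := by
  induction i using Fin.induction with
  | zero =>
    rw [nested_zero, show Finset.Iic (0 : Fin (m + 1)) = {0} from rfl, Finset.sum_singleton]
    exact CK_mem_polys ρ (mon_single_zero_mem _ v)
  | succ i ih =>
    rw [nested_succ, sum_Iic_succ]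
    refine CK_mem_polys ρ ?_
    rw [Iio_succ_succ]
    exact position_pow_mem ρ ih _

theorem dirac_nested (hμ : ∀ i, 0 < μ i) (j : Fin (m + 1) → ℕ) (v : V) (i : Fin (m + 1)) :
    dirac ρ μ (Finset.Iic i.succ) (nested ρ μ j v i) = 0 := by
  induction i using Fin.induction with
  | zero =>
    rw [nested_zero]
    exact dirac_CK ρ (hμ _) (mon_single_zero_mem _ v)
  | succ i ih =>
    rw [nested_succ]
    refine dirac_CK ρ (hμ _) (k := (∑ r ∈ Finset.Iic i.castSucc, j r) + j i.succ) ?_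
    rw [Iio_succ_succ]
    exact position_pow_mem ρ (nested_mem_polys ρ j v _) _

theorem nested_add (j : Fin (m + 1) → ℕ) (v w : V) (i : Fin (m + 1)) :
    nested ρ μ j (v + w) i = nested ρ μ j v i + nested ρ μ j w i := by
  induction i using Fin.induction with
  | zero =>
    simp only [nested_zero, map_add]
    exact CK_add ρ (mon_single_zero_mem _ v) (mon_single_zero_mem _ w)
  | succ i ih =>
    simp only [nested_succ, ih, map_add]
    refine CK_add ρ (k := (∑ r ∈ Finset.Iic i.castSucc, j r) + j i.succ) ?_ ?_ <;>
    · rw [Iio_succ_succ]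
      exact position_pow_mem ρ (nested_mem_polys ρ j _ _) _

theorem nested_smul (j : Fin (m + 1) → ℕ) (c : 𝕜) (v : V) (i : Fin (m + 1)) :
    nested ρ μ j (c • v) i = c • nested ρ μ j v i := by
  induction i using Fin.induction with
  | zero =>
    simp only [nested_zero, map_smul]
    exact CK_smul ρ c (mon_single_zero_mem _ v)
  | succ i ih =>
    simp only [nested_succ, ih, map_smul]
    refine CK_smul ρ c (k := (∑ r ∈ Finset.Iic i.castSucc, j r) + j i.succ) ?_
    rw [Iio_succ_succ]
    exact position_pow_mem ρ (nested_mem_polys ρ j _ _) _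

theorem sum_piAntidiag_insert {ι M : Type*} [DecidableEq ι] [AddCommMonoid M] {s : Finset ι}
    {a : ι} (ha : a ∉ s) (k : ℕ) (F : (ι → ℕ) → M) :
    ∑ j ∈ (insert a s).piAntidiag k, F j =
      ∑ p ∈ antidiagonal k, ∑ g ∈ s.piAntidiag p.2, F (g + Pi.single a p.1) := by
  rw [← Finset.cons_eq_insert _ _ ha, Finset.piAntidiag_cons, Finset.sum_disjiUnion]
  refine Finset.sum_congr rfl fun p _ => ?_
  rw [Finset.sum_map]
  refine Finset.sum_congr rfl fun g _ => congrArg F ?_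
  ext t
  simp [Pi.single_apply]

/-- The sum of nested extensions with prescribed vectors, in all exponents of total degree `k`. -/
noncomputable def nestedSum (μ : Fin (m + 2) → ℝ) (i : Fin (m + 1)) (k : ℕ)
    (w : (Fin (m + 1) → ℕ) → V) : MvPolynomial (Fin (m + 2)) 𝕜 ⊗[𝕜] V :=
  ∑ j ∈ (Finset.Iic i).piAntidiag k, nested ρ μ j (w j) i

theorem nestedSum_mem (hμ : ∀ i, 0 < μ i) (i : Fin (m + 1)) (k : ℕ)
    (w : (Fin (m + 1) → ℕ) → V) : nestedSum ρ μ i k w ∈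
      LinearMap.ker (dirac ρ μ (Finset.Iic i.succ)) ⊓ polys 𝕜 V (Finset.Iic i.succ) k := by
  refine sum_mem fun j hj => ⟨dirac_nested ρ hμ j _ i, ?_⟩
  rw [← (Finset.mem_piAntidiag.mp hj).1]
  exact nested_mem_polys ρ j _ i

theorem position_pow_nestedSum_mem (hμ : ∀ i, 0 < μ i) (i : Fin (m + 1)) {k : ℕ}
    {p : ℕ × ℕ} (hp : p ∈ antidiagonal k) (w : (Fin (m + 1) → ℕ) → V) :
    (position ρ (Finset.Iic i.succ) ^ p.1) (nestedSum ρ μ i p.2 w) ∈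
      polys 𝕜 V (Finset.Iic i.succ) k := by
  have := position_pow_mem ρ (nestedSum_mem ρ hμ i p.2 w).2 p.1
  have hk : p.2 + p.1 = k := (add_comm _ _).trans (mem_antidiagonal.mp hp)
  rwa [hk] at this

theorem nestedSum_zero (k : ℕ) (w : (Fin (m + 1) → ℕ) → V) :
    nestedSum ρ μ 0 k w = CK ρ μ 1 (mon 𝕜 (Finsupp.single 0 k) (w (Pi.single 0 k))) := by
  have : (Finset.Iic (0 : Fin (m + 1))).piAntidiag k = {Pi.single 0 k} := by
    rw [show Finset.Iic (0 : Fin (m + 1)) = insert 0 ∅ from rfl]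
    ext j
    simp only [Finset.mem_piAntidiag, Finset.mem_singleton, insert_empty_eq, Finset.sum_singleton]
    constructor
    · rintro ⟨rfl, h⟩
      ext r
      by_cases hr : r = 0
      · subst hr; simp
      · rw [Pi.single_eq_of_ne hr]
        by_contra h'
        exact hr (h r h')
    · rintro rfl
      refine ⟨by simp, fun r hr => ?_⟩
      by_contra h
      exact hr (Pi.single_eq_of_ne h _)
  rw [nestedSum, this, Finset.sum_singleton, nested_zero, Pi.single_eq_same]

theorem apply_succ_eq_zero {i : Fin m} {k : ℕ} {g : Fin (m + 1) → ℕ}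
    (hg : g ∈ (Finset.Iic i.castSucc).piAntidiag k) : g i.succ = 0 := by
  by_contra h
  simpa [Fin.le_def] using (Finset.mem_piAntidiag.mp hg).2 _ h

/-- Grouping the tuples by their last exponent `p.1` and using linearity, the argument of the outer
extension becomes a Fischer sum, to which existence and uniqueness apply. -/
theorem nestedSum_succ (hμ : ∀ i, 0 < μ i) (i : Fin m) (k : ℕ) (w : (Fin (m + 1) → ℕ) → V) :
    nestedSum ρ μ i.succ k w = CK ρ μ i.succ.succ (∑ p ∈ antidiagonal k,
      (position ρ (Finset.Iic i.castSucc.succ) ^ p.1)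
        (nestedSum ρ μ i.castSucc p.2 fun g => w (g + Pi.single i.succ p.1))) := by
  rw [CK_sum ρ (k := k), nestedSum, Iic_succ_eq_insert, sum_piAntidiag_insert (by simp)]
  · refine Finset.sum_congr rfl fun p hp => ?_
    rw [nestedSum, map_sum, CK_sum ρ (k := k)]
    · refine Finset.sum_congr rfl fun g hg => ?_
      have hc : nested ρ μ (g + Pi.single i.succ p.1) (w (g + Pi.single i.succ p.1)) i.castSucc =
          nested ρ μ g (w (g + Pi.single i.succ p.1)) i.castSucc := nested_congr ρ _ _ fun r hr => by
        have : r ≠ i.succ := (hr.trans_lt i.castSucc_lt_succ).ne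
        simp [this]
      have he : (g + Pi.single i.succ p.1 : Fin (m + 1) → ℕ) i.succ = p.1 := by
        simp [apply_succ_eq_zero hg]
      rw [nested_succ, hc, he]
    · intro g hg
      have hk : ∑ r ∈ Finset.Iic i.castSucc, g r + p.1 = k := by
        rw [(Finset.mem_piAntidiag.mp hg).1, add_comm]
        exact mem_antidiagonal.mp hp
      rw [Iio_succ_succ, ← hk]
      exact position_pow_mem ρ (nested_mem_polys ρ g _ _) _
  · intro p hp
    rw [Iio_succ_succ]
    exact position_pow_nestedSum_mem ρ hμ _ hp _

theorem index_weight_pos (hμ : ∀ i, 0 < μ i) (i : Fin (m + 2)) :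
    0 < ∑ r ∈ Finset.Iic i, (1 + 2 * μ r) :=
  Finset.sum_pos (fun r _ => by linarith [hμ r]) ⟨i, by simp⟩

/-- Every Dunkl monogenic is a sum of nested extensions. -/
theorem exists_nestedSum (hμ : ∀ i, 0 < μ i) (i : Fin (m + 1)) :
    ∀ (k : ℕ), ∀ f ∈ LinearMap.ker (dirac ρ μ (Finset.Iic i.succ)) ⊓
      polys 𝕜 V (Finset.Iic i.succ) k, ∃ w, nestedSum ρ μ i k w = f := by
  induction i using Fin.induction with
  | zero =>
    intro k f hf
    have hR := Iic_erase_self (Fin.succ (0 : Fin (m + 1))) ▸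
      restrictZero_mem (Fin.succ (0 : Fin (m + 1))) hf.2
    -- The restriction involves `x₁` alone, so it is `x₁ ^ k ⊗ v`.
    obtain ⟨v, hv⟩ := map_mem_of_mem_polys (L := LinearMap.id)
      (M := LinearMap.range (mon 𝕜 (Finsupp.single (0 : Fin (m + 2)) k) : V →ₗ[𝕜] _))
      (fun d v hA hk => by
        have h0 : ∀ r, r ≠ 0 → d r = 0 := fun r hr => hA r fun h => hr (by
          simpa [Fin.lt_def] using h)
        refine ⟨v, ?_⟩
        have : d = Finsupp.single 0 k := by
          ext r
          rw [Finset.sum_eq_single 0 (fun r _ => h0 r) (by simp)] at hk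
          by_cases hr : r = 0
          · rw [hr, hk, Finsupp.single_eq_same]
          · rw [h0 r hr, Finsupp.single_eq_of_ne hr]
        rw [this]
        rfl) hR
    refine ⟨fun _ => v, ?_⟩
    rw [nestedSum_zero, hv]
    exact CK_restrictZero ρ (hμ _) hf.2 hf.1
  | succ i ih =>
    intro k f hf
    have hR := Iic_erase_self i.succ.succ ▸ restrictZero_mem i.succ.succ hf.2
    rw [Iio_succ_succ] at hR
    obtain ⟨M, hM, e⟩ := exists_fischer_polys ρ (index_weight_pos hμ _) hR
    have hex : ∀ p : ℕ × ℕ, ∃ w, p ∈ antidiagonal k → nestedSum ρ μ i.castSucc p.2 w = M p := by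
      intro p
      by_cases hp : p ∈ antidiagonal k
      · obtain ⟨w, hw⟩ := ih p.2 (M p) (hM p hp)
        exact ⟨w, fun _ => hw⟩
      · exact ⟨0, fun h => absurd h hp⟩
    choose w hw using hex
    -- A tuple is decoded into its last exponent, the remaining degree, and the tuple with that
    -- exponent cleared.
    refine ⟨fun j => w (j i.succ, k - j i.succ) (Function.update j i.succ 0), ?_⟩
    rw [nestedSum_succ ρ hμ, ← CK_restrictZero ρ (hμ _) hf.2 hf.1, e]
    congr 1
    refine Finset.sum_congr rfl fun p hp => ?_
    rw [← hw p hp]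
    congr 1
    refine Finset.sum_congr rfl fun g hg => ?_
    have h0 : g i.succ = 0 := apply_succ_eq_zero hg
    have h1 : (g + Pi.single i.succ p.1 : Fin (m + 1) → ℕ) i.succ = p.1 := by simp [h0]
    have h2 : k - p.1 = p.2 := by
      have := mem_antidiagonal.mp hp
      omega
    have h3 : Function.update (g + Pi.single i.succ p.1) i.succ 0 = g := by
      ext r
      by_cases hr : r = i.succ
      · subst hr; simp [h0]
      · simp [hr]
    beta_reduce
    rw [h1, h2, h3]

/-- The vectors in a sum of nested extensions are determined by the sum. -/
theorem eq_zero_of_nestedSum_eq_zero (hμ : ∀ i, 0 < μ i) (i : Fin (m + 1)) :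
    ∀ (k : ℕ) (w : (Fin (m + 1) → ℕ) → V), nestedSum ρ μ i k w = 0 →
      ∀ j ∈ (Finset.Iic i).piAntidiag k, w j = 0 := by
  induction i using Fin.induction with
  | zero =>
    intro k w hw j hj
    have hj' : j = Pi.single 0 k := by
      obtain ⟨h1, h2⟩ := Finset.mem_piAntidiag.mp hj
      rw [show Finset.Iic (0 : Fin (m + 1)) = {0} from rfl, Finset.sum_singleton] at h1
      ext r
      by_cases hr : r = 0
      · rw [hr, h1, Pi.single_eq_same]
      · rw [Pi.single_eq_of_ne hr]
        by_contra h
        exact hr (by simpa using h2 r h)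
    rw [nestedSum_zero, ← hj'] at hw
    have h := restrictZero_CK ρ (hμ 1) (mon_single_zero_mem k (w j))
    rw [hw, map_zero, mon_apply] at h
    -- The coefficient of `x₁ ^ k` recovers the vector.
    have h' := congrArg ((TensorProduct.lid 𝕜 V).toLinearMap ∘ₗ TensorProduct.map
      (MvPolynomial.lcoeff 𝕜 (Finsupp.single (0 : Fin (m + 2)) k)) LinearMap.id) h
    simpa using h'.symm
  | succ i ih =>
    intro k w hw j hj
    have hmem : ∑ p ∈ antidiagonal k, (position ρ (Finset.Iic i.castSucc.succ) ^ p.1)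
        (nestedSum ρ μ i.castSucc p.2 fun g => w (g + Pi.single i.succ p.1)) ∈
          polys 𝕜 V (Finset.Iio i.succ.succ) k := by
      rw [Iio_succ_succ]
      exact sum_mem fun p hp => position_pow_nestedSum_mem ρ hμ _ hp _
    rw [nestedSum_succ ρ hμ] at hw
    -- Restriction undoes the outer extension, leaving a Fischer decomposition of zero.
    have h := restrictZero_CK ρ (hμ _) hmem
    rw [hw, map_zero] at h
    let M : ℕ × ℕ → MvPolynomial (Fin (m + 2)) 𝕜 ⊗[𝕜] V := fun p =>
      nestedSum ρ μ i.castSucc p.2 fun g => w (g + Pi.single i.succ p.1)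
    have hM : ∀ p ∈ antidiagonal k, M p ∈
        LinearMap.ker (dirac ρ μ (Finset.Iic i.castSucc.succ)) ⊓
          polys 𝕜 V (Finset.Iic i.castSucc.succ) p.2 := by
      intro p _
      have hp := nestedSum_mem ρ hμ i.castSucc p.2 (fun g => w (g + Pi.single i.succ p.1))
      have hp' : M p = nestedSum ρ μ i.castSucc p.2 fun g => w (g + Pi.single i.succ p.1) := rfl
      rw [hp']
      exact hp
    have hz := fischer_polys_unique ρ (index_weight_pos hμ i.castSucc.succ) hM h.symm
    rw [Iic_succ_eq_insert, Finset.piAntidiag_insert (by simp)] at hj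
    obtain ⟨p, hp, hj⟩ := Finset.mem_biUnion.mp hj
    obtain ⟨g, hg, rfl⟩ := Finset.mem_image.mp hj
    have := ih p.2 _ (hz p hp) g hg
    convert this using 2
    ext r
    simp [Pi.single_apply]

theorem monogenics_eq (k : ℕ) : monogenics ρ μ k =
    LinearMap.ker (dirac ρ μ (Finset.Iic (Fin.last m).succ)) ⊓
      polys 𝕜 V (Finset.Iic (Fin.last m).succ) k := by
  rw [monogenics, homogeneousV_eq_polys, Fin.succ_last, ← Fin.top_eq_last, Finset.Iic_top]

/-- The function `Ψ_j`, as a linear function of the vector. -/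
noncomputable def psiHom (μ : Fin (m + 2) → ℝ) (j : Fin (m + 1) → ℕ) :
    V →ₗ[𝕜] MvPolynomial (Fin (m + 2)) 𝕜 ⊗[𝕜] V where
  toFun v := Psi ρ μ j v
  map_add' v w := nested_add ρ j v w _
  map_smul' c v := nested_smul ρ j c v _

end Nested

end DunklDirac

/-! ### Transport of the basis of a power of `V`. -/

theorem proposition6 {𝕜 : Type*} [RCLike 𝕜] {m : ℕ} {V : Type*} [AddCommGroup V] [Module 𝕜 V]
    (ρ : DunklDirac.Cl 𝕜 (m + 2) →ₐ[𝕜] Module.End 𝕜 V)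
    (μ : Fin (m + 2) → ℝ) (hμ : ∀ i, 0 < μ i)
    {S : Type*} (v : Module.Basis S 𝕜 V) (k : ℕ) :
    ∃ b : Module.Basis ({j : Fin (m + 1) → ℕ // ∑ i, j i = k} × S) 𝕜
        (DunklDirac.monogenics ρ μ k),
      ∀ (j : {j : Fin (m + 1) → ℕ // ∑ i, j i = k}) (s : S),
        (b (j, s) : MvPolynomial (Fin (m + 2)) 𝕜 ⊗[𝕜] V) = DunklDirac.Psi ρ μ j.1 (v s) := by
  
  classical
  let _ : Fintype {j : Fin (m + 1) → ℕ // ∑ i, j i = k} :=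
    Fintype.subtype (Finset.univ.piAntidiag k) (by simp)
  let Φ : ({j : Fin (m + 1) → ℕ // ∑ i, j i = k} → V) →ₗ[𝕜] _ :=
    ∑ j, DunklDirac.psiHom ρ μ j.1 ∘ₗ LinearMap.proj j
  have hIic : Finset.Iic (Fin.last m) = Finset.univ := by
    rw [← Fin.top_eq_last, Finset.Iic_top]
  have hΦ : ∀ w : (Fin (m + 1) → ℕ) → V,
      Φ (fun j => w j.1) = DunklDirac.nestedSum ρ μ (Fin.last m) k w := by
    intro w
    rw [DunklDirac.nestedSum, hIic, Finset.sum_subtype _ (p := fun j => ∑ i, j i = k) (by simp)]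
    simp only [Φ, LinearMap.sum_apply]
    rfl
  -- Families on the admissible tuples are extended by zero, since `nestedSum` takes a function on
  -- all tuples.
  have hext : ∀ w : {j : Fin (m + 1) → ℕ // ∑ i, j i = k} → V,
      Φ w = DunklDirac.nestedSum ρ μ (Fin.last m) k
        fun j => if h : ∑ i, j i = k then w ⟨j, h⟩ else 0 := by
    intro w
    rw [← hΦ]
    congr 1
    ext j
    simp [j.2]
  have hmem : ∀ w, Φ w ∈ DunklDirac.monogenics ρ μ k := by
    intro w
    rw [hext, DunklDirac.monogenics_eq]
    exact DunklDirac.nestedSum_mem ρ hμ _ _ _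
  have hinj : Function.Injective (Φ.codRestrict _ hmem) := by
    rw [injective_iff_map_eq_zero]
    intro w hw
    have hw : Φ w = 0 := congrArg Subtype.val hw
    rw [hext] at hw
    ext j
    have := DunklDirac.eq_zero_of_nestedSum_eq_zero ρ hμ _ k _ hw j.1 (by
      rw [hIic]
      simp [j.2])
    simpa [j.2] using this
  have hsurj : Function.Surjective (Φ.codRestrict _ hmem) := by
    rintro ⟨f, hf⟩
    obtain ⟨w, hw⟩ := DunklDirac.exists_nestedSum ρ hμ (Fin.last m) k f
      (by rwa [DunklDirac.monogenics_eq] at hf)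
    exact ⟨fun j => w j.1, Subtype.ext ((hΦ w).trans hw)⟩
  -- The vector indexed by `(j, s)` is the family equal to `v s` at `j` and zero elsewhere, so only
  -- the summand at `j` survives in `Φ`.
  refine ⟨((Pi.basis fun _ => v).reindex (Equiv.sigmaEquivProd _ _)).map
    (LinearEquiv.ofBijective _ ⟨hinj, hsurj⟩), fun j s => ?_⟩
  rw [Module.Basis.map_apply, Module.Basis.reindex_apply, Pi.basis_apply]
  change Φ (Pi.single j (v s)) = _
  simp only [Φ, LinearMap.sum_apply, LinearMap.comp_apply, LinearMap.proj_apply]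
  rw [Finset.sum_eq_single j (fun j' _ h => by rw [Pi.single_eq_of_ne h, map_zero]) (by simp),
    Pi.single_eq_same]
  rfl
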